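/- Let $d\in\mathbb N=\{1,2,\dots\}$ and $1\le p<\infty$. All functions are complex-valued. **Faber system.** Let $v(x)=\max\{0,1-|2x-1|\}$ be the hat function on $[0,1]$. On $[0,1]$ put $v_{-1,0}(x)=1-x$, $v_{-1,1}(x)=x$ and, for $j\in\mathbb N_0$, $v_{j,k}(x)=v(2^jx-k)$. Let $\mathbb D_{-1}=\{0,1\}$ and $\mathbb D_j=\{0,1,\dots,2^j-1\}$ for $j\in\mathbb N_0$. For $j\in\mathbb N_{-1}^d$, where $\mathbb N_{-1}=\{-1,0,1,\dots\}$, let $\mathbb D_j=\mathbb D_{j_1}\times\cdots\times\mathbb D_{j_d}$, $|j|_1=\sum_i|j_i|$, $e(j)=\{i:j_i\ne-1\}$, and for $k\in\mathbb D_j$ let $v_{j,k}(x)=\prod_i v_{j_i,k_i}(x_i)$, $x_{j,k}=(2^{-\max\{j_i,0\}}k_i)_{i=1}^d$. For a continuous function $f$ on $[0,1]^d$ put $$d^2_{j,k}(f)=(-2)^{-|e(j)|}\Big(\prod_{i\in e(j)}\Delta^{2,i}_{2^{-(j_i+1)}}\Big)f(x_{j,k}),\qquad I_nf=\sum_{j\in\mathbb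 N_{-1}^d,\ |j|_1\le n}\ \sum_{k\in\mathbb D_j}d^2_{j,k}(f)\,v_{j,k},$$ where $\Delta^{2,i}_hf(x)=f(x+2he_i)-2f(x+he_i)+f(x)$ and $e_i$ is the $i$-th unit vector. **Besov space.** Fix $\varphi=(\varphi_n)_{n\ge0}\subset C_0^\infty(\mathbb R)$ with $\operatorname{supp}\varphi_0\subset\{|x|\le2\}$, $\operatorname{supp}\varphi_n\subset\{2^{n-1}\le|x|\le2^{n+1}\}$ for $n\ge1$, $\sup_{x,n}2^{n\ell}|D^\ell\varphi_n(x)|<\infty$ for every $\ell\in\mathbb N_0$, and $\sum_n\varphi_n\equiv1$. For $g\in L_1(\mathbb R^d)$ and $\ell\in\mathbb N_0^d$ let $g_\ell=\mathcal F^{-1}[\varphi_{\ell_1}(\xi_1)\cdots\varphi_{\ell_d}(\xi_d)\mathcal Fg(\xi)]$, where $\mathcal F$ is the Fourier transform $\mathcal Fg(\xi)=(2\pi)^{-d/2}\int g(x)e^{-i\xi\cdot x}\,dx$. The space $S^{1/p}_{p,1}B(\mathbb R^d)$ consists of all $g\in L_1(\mathbb R^d)$ with $$\|g|S^{1/p}_{p,1}B(\mathbb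 R^d)\|=\sum_{\ell\in\mathbb N_0^d}2^{|\ell|_1/p}\|g_\ell\|_{L_p(\mathbb R^d)}<\infty.$$ The space $S^{1/p}_{p,1}B([0,1]^d)$ consists of all $f\in L_1([0,1]^d)$ such that $g|_{[0,1]^d}=f$ (almost everywhere) for some $g\in S^{1/p}_{p,1}B(\mathbb R^d)$, and $\|f|S^{1/p}_{p,1}B([0,1]^d)\|$ is the infimum of $\|g|S^{1/p}_{p,1}B(\mathbb R^d)\|$ over all such $g$. **Theorem.** There is a constant $C>0$, depending only on $d$, $p$ and $\varphi$, such that the following holds. Every $f\in S^{1/p}_{p,1}B([0,1]^d)$ has a (unique) representative that is continuous on $[0,1]^d$, and, with $I_nf$ formed from the values of this representative, $$\|f-I_nf\|_{L_p([0,1]^d)}\le C\,2^{-n/p}\,n^{d-1}\,\|f|S^{1/p}_{p,1}B([0,1]^d)\|\qquad\text{for all integers } n\ge1 .$$ -/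

import Mathlib

open MeasureTheory
open scoped ENNReal ContDiff

noncomputable section

namespace FaberBesov

/-! ### The tensor Faber system on the unit cube -/

/-- The unit cube `[0,1]^d`. -/
def cube (d : ℕ) : Set (Fin d → ℝ) := Set.Icc 0 1

/-- The hat function `v(x) = 2 ∫₀ˣ h(t) dt` with `h` the Haar function: `2 x` on `[0, 1/2]`,
`2 - 2 x` on `[1/2, 1]`, and zero elsewhere. -/
def hat (x : ℝ) : ℝ := max 0 (1 - |2 * x - 1|)

/-- The univariate Faber functions on `[0,1]`: `v_{-1,0}(x) = 1 - x`, `v_{-1,1}(x) = x` and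
`v_{j,k}(x) = v(2^j x - k)` for `j ≥ 0`. -/
def faber₁ (j : ℤ) (k : ℕ) (x : ℝ) : ℝ :=
  if j = -1 then (if k = 0 then 1 - x else x) else hat ((2 : ℝ) ^ j * x - k)

/-- The univariate translation sets `𝔻_{-1} = {0, 1}` and `𝔻_j = {0, …, 2^j - 1}` for `j ≥ 0`. -/
def trans₁ (j : ℤ) : Finset ℕ := if j = -1 then {0, 1} else Finset.range (2 ^ j.toNat)

/-- The tensor Faber function `v_{j,k}(x) = ∏ i, v_{j_i,k_i}(x_i)`. -/
def faber {d : ℕ} (j : Fin d → ℤ) (k : Fin d → ℕ) (x : Fin d → ℝ) : ℝ :=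
  ∏ i, faber₁ (j i) (k i) (x i)

/-- `𝔻_j = 𝔻_{j_1} × ⋯ × 𝔻_{j_d}`. -/
def trans {d : ℕ} (j : Fin d → ℤ) : Finset (Fin d → ℕ) :=
  Fintype.piFinset fun i => trans₁ (j i)

/-- The second order difference with step `h` in the direction of the `i`-th coordinate. -/
def secondDiff {d : ℕ} (i : Fin d) (h : ℝ) (f : (Fin d → ℝ) → ℂ) : (Fin d → ℝ) → ℂ :=
  fun x => f (x + Pi.single i (2 * h)) - 2 * f (x + Pi.single i h) + f x

/-- The mixed second order difference: the composition, over all `i ∈ e`, of the (commuting)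
operators `secondDiff i (h i)`. -/
def mixedSecondDiff {d : ℕ} (e : Finset (Fin d)) (h : Fin d → ℝ) (f : (Fin d → ℝ) → ℂ) :
    (Fin d → ℝ) → ℂ :=
  (List.finRange d).foldr (fun i g => if i ∈ e then secondDiff i (h i) g else g) f

/-- `e(j) = {i : j_i ≠ -1}`. -/
def active {d : ℕ} (j : Fin d → ℤ) : Finset (Fin d) := {i | j i ≠ -1}

/-- The point `x_{j,k} = (2^{-(j_i)_+} k_i)_i`. -/
def node {d : ℕ} (j : Fin d → ℤ) (k : Fin d → ℕ) : Fin d → ℝ :=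
  fun i => (2 : ℝ) ^ (-(max (j i) 0)) * k i

/-- The Faber-Schauder coefficient
`d²_{j,k}(f) = (-2)^{-|e(j)|} Δ^{2,e(j)}_{2^{-(j+1)}}(f, x_{j,k})`. -/
def faberCoeff {d : ℕ} (j : Fin d → ℤ) (k : Fin d → ℕ) (f : (Fin d → ℝ) → ℂ) : ℂ :=
  ((-2 : ℂ) ^ (active j).card)⁻¹ *
    mixedSecondDiff (active j) (fun i => (2 : ℝ) ^ (-(j i + 1))) f (node j k)

/-- The levels `j ∈ {-1, 0, 1, …}^d` with `|j|_1 = ∑ i, |j_i| ≤ n`. -/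
def levels (d n : ℕ) : Finset (Fin d → ℤ) :=
  {j ∈ Fintype.piFinset fun _ : Fin d => Finset.Icc (-1 : ℤ) n | ∑ i, |j i| ≤ (n : ℤ)}

/-- The truncated Faber-Schauder series
`I_n f = ∑_{|j|_1 ≤ n} ∑_{k ∈ 𝔻_j} d²_{j,k}(f) v_{j,k}`. -/
def smolyak {d : ℕ} (n : ℕ) (f : (Fin d → ℝ) → ℂ) (x : Fin d → ℝ) : ℂ :=
  ∑ j ∈ levels d n, ∑ k ∈ trans j, faberCoeff j k f * (faber j k x : ℂ)

/-! ### Besov spaces of dominating mixed smoothness -/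

/-- The class `Φ(ℝ)` of smooth dyadic decompositions of unity. -/
structure IsDyadicUnity (φ : ℕ → ℝ → ℂ) : Prop where
  smooth : ∀ n, ContDiff ℝ ∞ (φ n)
  supp_zero : tsupport (φ 0) ⊆ {x | |x| ≤ 2}
  supp_succ : ∀ n, 1 ≤ n →
    tsupport (φ n) ⊆ {x | (2 : ℝ) ^ ((n : ℤ) - 1) ≤ |x| ∧ |x| ≤ (2 : ℝ) ^ ((n : ℤ) + 1)}
  deriv_bound : ∀ l : ℕ, ∃ c : ℝ, ∀ (n : ℕ) (x : ℝ),
    (2 : ℝ) ^ (n * l) * ‖iteratedDeriv l (φ n) x‖ ≤ c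
  sum_eq_one : ∀ x, HasSum (fun n => φ n x) 1

/-- `ℱ f(ξ) = (2π)^{-d/2} ∫ f(x) e^{-i ξ·x} dx`. -/
def fourier {d : ℕ} (f : (Fin d → ℝ) → ℂ) (ξ : Fin d → ℝ) : ℂ :=
  (((2 * Real.pi) ^ (-(d : ℝ) / 2) : ℝ) : ℂ) *
    ∫ x : Fin d → ℝ, f x * Complex.exp (-Complex.I * ((∑ i, ξ i * x i : ℝ) : ℂ))

/-- `ℱ⁻¹ f(ξ) = (2π)^{-d/2} ∫ f(x) e^{i ξ·x} dx`. -/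
def fourierInv {d : ℕ} (f : (Fin d → ℝ) → ℂ) (ξ : Fin d → ℝ) : ℂ :=
  (((2 * Real.pi) ^ (-(d : ℝ) / 2) : ℝ) : ℂ) *
    ∫ x : Fin d → ℝ, f x * Complex.exp (Complex.I * ((∑ i, ξ i * x i : ℝ) : ℂ))

/-- The building block `f_l = ℱ⁻¹[φ_{l_1}(ξ_1) ⋯ φ_{l_d}(ξ_d) ℱ f(ξ)]`. -/
def block {d : ℕ} (φ : ℕ → ℝ → ℂ) (f : (Fin d → ℝ) → ℂ) (l : Fin d → ℕ) :
    (Fin d → ℝ) → ℂ :=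
  fourierInv fun ξ => (∏ i, φ (l i) (ξ i)) * fourier f ξ

/-- The (extended) norm `(∑_{l ∈ ℕ₀^d} 2^{|l|_1 r q} ‖f_l‖_p^q)^{1/q}` of `S^r_{p,q}B(ℝ^d)`,
for integrable `f` and `0 < p, q ≤ ∞`, with the supremum in place of the sum if `q = ∞`. -/
def besovNorm {d : ℕ} (φ : ℕ → ℝ → ℂ) (r : ℝ) (p q : ℝ≥0∞) (f : (Fin d → ℝ) → ℂ) : ℝ≥0∞ :=
  if q = ⊤ then
    ⨆ l : Fin d → ℕ,
      ENNReal.ofReal ((2 : ℝ) ^ (r * ((∑ i, l i : ℕ) : ℝ))) * eLpNorm (block φ f l) p volume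
  else
    (∑' l : Fin d → ℕ,
      (ENNReal.ofReal ((2 : ℝ) ^ (r * ((∑ i, l i : ℕ) : ℝ))) *
        eLpNorm (block φ f l) p volume) ^ q.toReal) ^ (1 / q.toReal)

/-- Membership in `S^r_{p,q}B(ℝ^d)`. -/
def MemBesov {d : ℕ} (φ : ℕ → ℝ → ℂ) (r : ℝ) (p q : ℝ≥0∞) (f : (Fin d → ℝ) → ℂ) : Prop :=
  Integrable f volume ∧ besovNorm φ r p q f < ⊤

/-- `g` is an extension of `f` from `Ω` that lies in `S^r_{p,q}B(ℝ^d)`; as elements of `L_1`,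
functions are identified if they agree almost everywhere. -/
def IsBesovExtension {d : ℕ} (φ : ℕ → ℝ → ℂ) (r : ℝ) (p q : ℝ≥0∞) (Ω : Set (Fin d → ℝ))
    (f g : (Fin d → ℝ) → ℂ) : Prop :=
  MemBesov φ r p q g ∧ g =ᵐ[volume.restrict Ω] f

/-- Membership in `S^r_{p,q}B(Ω)`. Only the values of `f` on `Ω` matter. -/
def MemBesovOn {d : ℕ} (φ : ℕ → ℝ → ℂ) (r : ℝ) (p q : ℝ≥0∞) (Ω : Set (Fin d → ℝ))
    (f : (Fin d → ℝ) → ℂ) : Prop :=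
  IntegrableOn f Ω volume ∧ ∃ g, IsBesovExtension φ r p q Ω f g

/-- The norm of `S^r_{p,q}B(Ω)`: the infimum of the norms of all extensions. -/
def besovNormOn {d : ℕ} (φ : ℕ → ℝ → ℂ) (r : ℝ) (p q : ℝ≥0∞) (Ω : Set (Fin d → ℝ))
    (f : (Fin d → ℝ) → ℂ) : ℝ≥0∞ :=
  ⨅ (g : (Fin d → ℝ) → ℂ) (_ : IsBesovExtension φ r p q Ω f g), besovNorm φ r p q g

/-- `F` is a representative of (the class of) `f` that is continuous on `Ω`. For `Ω = [0,1]^d`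
its values on `Ω` are determined by the class of `f`; they are the point values of `f` that enter
a Faber-Schauder series. -/
def IsContinuousRep {d : ℕ} (Ω : Set (Fin d → ℝ)) (f F : (Fin d → ℝ) → ℂ) : Prop :=
  ContinuousOn F Ω ∧ F =ᵐ[volume.restrict Ω] f

end FaberBesov

end

/-! Choose an extension `g` of `f` and split it into blocks `g_l`, band-limited to `|ξ_i| ≤
2^(l_i+1)`. Everything rests on one bound for the part of level `j` of the Faber expansion of one
block, valid for all `l` and `j` (`exists_block_estimates`): ‖layer j g_l‖_{L_p([0,1]^d)} ≤ M
2^(-|j|_1/p) 2^(|l|_1/p) ‖g_l‖_p. Summed over `l`, the right side is exactly the Besov norm with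
smoothness 1/p and q = 1, so layer `j` of `f` has norm at most M 2^(-|j|_1/p) ‖g‖. The error f - I_n
f is the sum of the layers with |j|_1 > n. Only O(s^(d-1)) levels have |j|_1 = s, and summing the
geometric decay gives n^(d-1) 2^(-n/p).

For the block bound, `g_l` equals its own convolution with a tensor kernel ⊗ κ_{l_i}. Hence layer
`j` of `g_l` is an integral operator applied to `g_l`, and its kernel is a product of univariate
layers of the translates κ_{l_i}(· - y_i). The Schur test `lintegral_rpow_kernel_le` combines two
L_1 bounds. In `y`, each factor has bounded mass, because a layer is a difference of piecewise
linear interpolants, which are convex combinations of two translates. In `x`, each factor has mass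
O(2^(l_i - |j_i|)), because Faber coefficients are controlled by the variation of the kernel on
disjoint cells. The first bound enters with power 1 - 1/p, the second with power 1/p.

The same kernel yields Nikolskii's inequality, so the series of blocks converges uniformly. Its sum
is the continuous representative (`tsum_block_ae_eq`).

Layers are finite combinations of point evaluations in the cube. Such functionals commute with
integrals and pointwise convergent sums, see only values on the cube, and are determined by products
of univariate functions (`pointFunctionals_ext`), which reduces multivariate identities to one
variable. -/

noncomputable section

namespace FaberBesov

/-! ### Fourier integrals -/

/-- The plane wave `e^{i ξ·x}`. -/
def wave {d : ℕ} (ξ x : Fin d → ℝ) : ℂ := Complex.exp (Complex.I * ((∑ i, ξ i * x i : ℝ) : ℂ))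

/-- The constant `(2π)^{-d/2}`. -/
def fourierConst (d : ℕ) : ℂ := (((2 * Real.pi) ^ (-(d : ℝ) / 2) : ℝ) : ℂ)

section Waves

variable {d : ℕ}

theorem norm_wave (ξ x : Fin d → ℝ) : ‖wave ξ x‖ = 1 := by
  rw [wave, mul_comm, Complex.norm_exp_ofReal_mul_I]

theorem wave_comm (ξ x : Fin d → ℝ) : wave ξ x = wave x ξ := by
  simp only [wave, mul_comm]

theorem wave_neg (ξ x : Fin d → ℝ) : wave (-ξ) x = wave ξ (-x) := by
  simp [wave]

theorem wave_eq_prod (ξ x : Fin d → ℝ) :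
    wave ξ x = ∏ i, Complex.exp (Complex.I * ((ξ i * x i : ℝ) : ℂ)) := by
  rw [wave, Complex.ofReal_sum, Finset.mul_sum, Complex.exp_sum]

theorem continuous_wave : Continuous fun z : (Fin d → ℝ) × (Fin d → ℝ) => wave z.1 z.2 := by
  unfold wave
  fun_prop

theorem continuous_wave_left (x : Fin d → ℝ) : Continuous fun ξ => wave ξ x := by
  unfold wave
  fun_prop

theorem continuous_wave_right (ξ : Fin d → ℝ) : Continuous fun x => wave ξ x := by
  unfold wave
  fun_prop

theorem fourierInv_eq (f : (Fin d → ℝ) → ℂ) (ξ : Fin d → ℝ) :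
    fourierInv f ξ = fourierConst d * ∫ x, f x * wave ξ x := rfl

theorem fourier_eq_fourierInv (f : (Fin d → ℝ) → ℂ) (ξ : Fin d → ℝ) :
    fourier f ξ = fourierInv f (-ξ) := by
  simp [fourier, fourierInv]

theorem integrable_mul_wave {f : (Fin d → ℝ) → ℂ} (hf : Integrable f) (ξ : Fin d → ℝ) :
    Integrable fun x => f x * wave ξ x :=
  hf.mul_bdd (c := 1) (continuous_wave_right ξ).aestronglyMeasurable
    (Filter.Eventually.of_forall fun x => (norm_wave ξ x).le)

theorem continuous_fourierInv {f : (Fin d → ℝ) → ℂ} (hf : Integrable f) :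
    Continuous (fourierInv f) := by
  refine continuous_const.mul (continuous_of_dominated (F := fun ξ x => f x * wave ξ x)
    (bound := fun x => ‖f x‖) (fun ξ => (integrable_mul_wave hf ξ).aestronglyMeasurable)
    (fun ξ => Filter.Eventually.of_forall fun x => ?_) hf.norm
    (Filter.Eventually.of_forall fun x => continuous_const.mul (continuous_wave_left x)))
  rw [norm_mul, norm_wave, mul_one]

theorem norm_fourierInv_le (f : (Fin d → ℝ) → ℂ) (ξ : Fin d → ℝ) :
    ‖fourierInv f ξ‖ ≤ ‖fourierConst d‖ * ∫ x, ‖f x‖ := by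
  rw [fourierInv_eq, norm_mul]
  gcongr
  refine (norm_integral_le_integral_norm _).trans (le_of_eq ?_)
  simp only [norm_mul, norm_wave, mul_one]

theorem continuous_fourier {f : (Fin d → ℝ) → ℂ} (hf : Integrable f) :
    Continuous (fourier f) := by
  have : fourier f = fun ξ => fourierInv f (-ξ) := funext (fourier_eq_fourierInv f)
  rw [this]
  exact (continuous_fourierInv hf).comp continuous_neg

theorem norm_fourier_le (f : (Fin d → ℝ) → ℂ) (ξ : Fin d → ℝ) :
    ‖fourier f ξ‖ ≤ ‖fourierConst d‖ * ∫ x, ‖f x‖ := by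
  rw [fourier_eq_fourierInv]
  exact norm_fourierInv_le f _

/-- Fubini, since the plane wave is symmetric in its two arguments. This duality replaces inversion
for functions that are merely integrable. -/
theorem integral_mul_fourierInv {f g : (Fin d → ℝ) → ℂ} (hf : Integrable f) (hg : Integrable g) :
    ∫ x, f x * fourierInv g x = ∫ ξ, fourierInv f ξ * g ξ := by
  have hint : Integrable (Function.uncurry fun x ξ => f x * g ξ * wave x ξ)
      (volume.prod volume) :=
    (hf.mul_prod hg).mul_bdd (c := 1) continuous_wave.aestronglyMeasurable
      (Filter.Eventually.of_forall fun z => (norm_wave z.1 z.2).le)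
  calc ∫ x, f x * fourierInv g x
      = fourierConst d * ∫ x, ∫ ξ, f x * g ξ * wave x ξ := by
        rw [← integral_const_mul]
        refine integral_congr_ae (Filter.Eventually.of_forall fun x => ?_)
        simp only [fourierInv_eq, mul_assoc, integral_const_mul]
        ring
    _ = fourierConst d * ∫ ξ, ∫ x, f x * g ξ * wave x ξ := by rw [integral_integral_swap hint]
    _ = ∫ ξ, fourierInv f ξ * g ξ := by
        rw [← integral_const_mul]
        refine integral_congr_ae (Filter.Eventually.of_forall fun ξ => ?_)
        simp only [fourierInv_eq, mul_assoc]
        rw [← integral_mul_const]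
        congr 2
        funext x
        rw [wave_comm ξ x]
        ring

theorem integral_mul_fourier {f g : (Fin d → ℝ) → ℂ} (hf : Integrable f) (hg : Integrable g) :
    ∫ x, f x * fourier g x = ∫ ξ, fourier f ξ * g ξ := by
  have h := integral_mul_fourierInv hf.comp_neg hg
  rw [← integral_neg_eq_self]
  simp only [fourier_eq_fourierInv, neg_neg]
  rw [h]
  refine integral_congr_ae (Filter.Eventually.of_forall fun ξ => ?_)
  simp only [fourierInv_eq]
  congr 2
  rw [← integral_neg_eq_self]
  simp only [neg_neg, wave_neg]

theorem fourierConst_sq : fourierConst d * fourierConst d * ((2 * Real.pi : ℝ) : ℂ) ^ d = 1 := by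
  have h : (0 : ℝ) < 2 * Real.pi := by positivity
  rw [fourierConst]
  rw [← Complex.ofReal_mul, ← Complex.ofReal_pow, ← Complex.ofReal_mul, ← Real.rpow_natCast,
    ← Real.rpow_add h, ← Real.rpow_add h,
    show -(d : ℝ) / 2 + -(d : ℝ) / 2 + d = 0 by ring, Real.rpow_zero, Complex.ofReal_one]

open FourierTransform in
/-- Fourier inversion for test functions. -/
theorem fourier_fourierInv_of_contDiff {ψ : (Fin d → ℝ) → ℂ} (hψ : ContDiff ℝ ∞ ψ)
    (hs : HasCompactSupport ψ) :
    Integrable (fourierInv ψ) ∧ ∀ x, fourier (fourierInv ψ) x = ψ x := by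
  let e : EuclideanSpace ℝ (Fin d) ≃L[ℝ] (Fin d → ℝ) := EuclideanSpace.equiv (Fin d) ℝ
  have hψe : ContDiff ℝ ∞ (ψ ∘ e) := hψ.comp e.contDiff
  have hse : HasCompactSupport (ψ ∘ e) := hs.comp_homeomorph e.toHomeomorph
  let Ψ : SchwartzMap (EuclideanSpace ℝ (Fin d)) ℂ := hse.toSchwartzMap hψe
  let Φ : SchwartzMap (EuclideanSpace ℝ (Fin d)) ℂ := 𝓕⁻ Ψ
  have hπ : (2 * Real.pi : ℝ) ≠ 0 := by positivity
  have hmp := PiLp.volume_preserving_toLp (Fin d)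
  have hemb : MeasurableEmbedding (WithLp.toLp 2 : (Fin d → ℝ) → EuclideanSpace ℝ (Fin d)) :=
    (MeasurableEquiv.toLp 2 (Fin d → ℝ)).measurableEmbedding
  have hinner : ∀ v w : Fin d → ℝ, inner ℝ (WithLp.toLp 2 v : EuclideanSpace ℝ (Fin d))
      (WithLp.toLp 2 w) = ∑ i, w i * v i := by
    intro v w
    simp [PiLp.inner_apply]
  -- The Schwartz-space transform `𝓕⁻` uses the phase `2π x·ξ`, so the two normalizations differ by
  -- the dilation by `2π` and a constant.
  have h1 : ∀ ξ, fourierInv ψ ξ = fourierConst d * Φ (WithLp.toLp 2 ((2 * Real.pi)⁻¹ • ξ)) := by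
    intro ξ
    rw [fourierInv_eq]
    congr 1
    change _ = (𝓕⁻ Ψ) _
    rw [SchwartzMap.fourierInv_coe, Real.fourierInv_eq', ← hmp.integral_comp hemb]
    refine integral_congr_ae (Filter.Eventually.of_forall fun x => ?_)
    simp only
    rw [smul_eq_mul, mul_comm]
    congr 1
    rw [hinner, wave]
    congr 1
    rw [mul_comm Complex.I]
    congr 2
    rw [Finset.mul_sum]
    refine Finset.sum_congr rfl fun i _ => ?_
    simp only [Pi.smul_apply, smul_eq_mul]
    field_simp
  have hΦ : Integrable fun η : Fin d → ℝ => Φ (WithLp.toLp 2 η) :=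
    (hmp.integrable_comp_emb hemb).2 Φ.integrable
  refine ⟨?_, fun x => ?_⟩
  · have : fourierInv ψ = fun ξ => fourierConst d * Φ (WithLp.toLp 2 ((2 * Real.pi)⁻¹ • ξ)) :=
      funext h1
    rw [this]
    exact (hΦ.comp_smul (inv_ne_zero hπ)).const_mul _
  · have h2 : ψ x = ∫ η : Fin d → ℝ, Φ (WithLp.toLp 2 η) * wave (-x) ((2 * Real.pi) • η) := by
      have h3 : ψ x = (𝓕 Φ) (WithLp.toLp 2 x) := by
        change _ = (𝓕 (𝓕⁻ Ψ)) _
        rw [FourierTransform.fourier_fourierInv_eq]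
        rfl
      rw [h3, SchwartzMap.fourier_coe, Real.fourier_eq', ← hmp.integral_comp hemb]
      refine integral_congr_ae (Filter.Eventually.of_forall fun η => ?_)
      simp only
      rw [smul_eq_mul, mul_comm]
      congr 1
      rw [hinner, wave]
      congr 1
      rw [mul_comm Complex.I]
      congr 2
      rw [Finset.mul_sum]
      refine Finset.sum_congr rfl fun i _ => ?_
      simp only [Pi.smul_apply, Pi.neg_apply, smul_eq_mul]
      ring
    -- The Jacobian `(2π)^d` of this dilation cancels the two factors `(2π)^(-d/2)`.
    have h4 := Measure.integral_comp_smul (volume : Measure (Fin d → ℝ))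
      (fun η => Φ (WithLp.toLp 2 η) * wave (-x) ((2 * Real.pi) • η)) (2 * Real.pi)⁻¹
    simp only [smul_inv_smul₀ hπ] at h4
    rw [← h2] at h4
    rw [fourier_eq_fourierInv, fourierInv_eq]
    simp only [h1, mul_assoc]
    rw [integral_const_mul, h4, Module.finrank_fin_fun, Complex.real_smul, ← inv_pow, inv_inv,
      abs_of_pos (by positivity), ← mul_assoc, ← mul_assoc, Complex.ofReal_pow, fourierConst_sq,
      one_mul]

end Waves

/-! ### Finite combinations of point evaluations -/

/-- The functionals on functions that are finite linear combinations of evaluations at points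
of `S`. -/
def pointFunctionals {E : Type*} (S : Set E) : Submodule ℂ ((E → ℂ) → ℂ) :=
  Submodule.span ℂ ((fun a f => f a) '' S)

theorem eval_mem_pointFunctionals {E : Type*} {S : Set E} {a : E} (ha : a ∈ S) :
    (fun f : E → ℂ => f a) ∈ pointFunctionals S :=
  Submodule.subset_span ⟨a, ha, rfl⟩

theorem pointFunctionals_congr {E : Type*} {S : Set E} {L : (E → ℂ) → ℂ}
    (hL : L ∈ pointFunctionals S) {f g : E → ℂ} (h : Set.EqOn f g S) : L f = L g := by
  induction hL using Submodule.span_induction with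
  | mem L hL => obtain ⟨a, ha, rfl⟩ := hL; exact h ha
  | zero => rfl
  | add L M _ _ hL hM => simp [hL, hM]
  | smul c L _ hL => simp [hL]

theorem pointFunctionals_integral {E α : Type*} [MeasurableSpace α] {μ : Measure α} {S : Set E}
    {L : (E → ℂ) → ℂ} (hL : L ∈ pointFunctionals S) {F : E → α → ℂ}
    (hF : ∀ a ∈ S, Integrable (F a) μ) :
    Integrable (fun y => L fun a => F a y) μ ∧
      L (fun a => ∫ y, F a y ∂μ) = ∫ y, L (fun a => F a y) ∂μ := by
  induction hL using Submodule.span_induction with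
  | mem L hL => obtain ⟨a, ha, rfl⟩ := hL; exact ⟨hF a ha, rfl⟩
  | zero => simp
  | add L M _ _ hL hM =>
    refine ⟨hL.1.add hM.1, ?_⟩
    simp only [Pi.add_apply]
    rw [integral_add hL.1 hM.1, hL.2, hM.2]
  | smul c L _ hL =>
    refine ⟨hL.1.const_mul c, ?_⟩
    simp only [Pi.smul_apply, smul_eq_mul]
    rw [integral_const_mul, hL.2]

theorem pointFunctionals_hasSum {E ι : Type*} {S : Set E} {L : (E → ℂ) → ℂ}
    (hL : L ∈ pointFunctionals S) {u : ι → E → ℂ} {f : E → ℂ}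
    (h : ∀ a ∈ S, HasSum (fun i => u i a) (f a)) : HasSum (fun i => L (u i)) (L f) := by
  induction hL using Submodule.span_induction with
  | mem L hL => obtain ⟨a, ha, rfl⟩ := hL; exact h a ha
  | zero => exact hasSum_zero
  | add L M _ _ hL hM => exact hL.add hM
  | smul c L _ hL => exact hL.mul_left c

/-- Point functionals that agree on all products of univariate functions are equal. -/
theorem pointFunctionals_ext {ι X : Type*} [Fintype ι] {S : Set (ι → X)}
    {L M : ((ι → X) → ℂ) → ℂ} (hL : L ∈ pointFunctionals S) (hM : M ∈ pointFunctionals S)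
    (h : ∀ w : ι → X → ℂ, L (fun x => ∏ i, w i (x i)) = M (fun x => ∏ i, w i (x i))) :
    L = M := by
  classical
  have hD := (pointFunctionals S).sub_mem hL hM
  obtain ⟨c, -, hc⟩ := (Finsupp.mem_span_image_iff_linearCombination ℂ).1 hD
  have hval : ∀ f, (L - M) f = ∑ a ∈ c.support, c a * f a := by
    intro f
    rw [← hc, Finsupp.linearCombination_apply, Finsupp.sum, Finset.sum_apply]
    rfl
  have hzero : ∀ a ∈ c.support, c a = 0 := by
    intro a ha
    -- The indicator of the single point `a` is a product of univariate indicators, and testing on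
    -- it isolates the coefficient `c a`.
    have h1 := hval (fun x => ∏ i, (fun i t => if t = a i then (1 : ℂ) else 0) i (x i))
    rw [Pi.sub_apply, h fun i t => if t = a i then (1 : ℂ) else 0, sub_self,
      Finset.sum_eq_single a] at h1
    · simpa using h1.symm
    · intro b _ hb
      obtain ⟨i, hi⟩ := Function.ne_iff.1 hb
      rw [Finset.prod_eq_zero (Finset.mem_univ i) (by simp [hi]), mul_zero]
    · exact fun h => absurd ha h
  rw [← sub_eq_zero]
  funext f
  rw [hval]
  exact Finset.sum_eq_zero fun a ha => by rw [hzero a ha, zero_mul]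

/-! ### The layers of the Faber expansion -/

/-- The univariate second difference. -/
def secondDiff₁ (h : ℝ) (w : ℝ → ℂ) : ℝ → ℂ :=
  fun x => w (x + 2 * h) - 2 * w (x + h) + w x

theorem secondDiff_prod {d : ℕ} (i : Fin d) (h : ℝ) (w : Fin d → ℝ → ℂ) :
    secondDiff i h (fun x => ∏ m, w m (x m)) =
      fun x => ∏ m, Function.update w i (secondDiff₁ h (w i)) m (x m) := by
  funext x
  have key : ∀ t : ℝ, ∏ m, w m ((x + Pi.single i t : Fin d → ℝ) m) =
      w i (x i + t) * ∏ m ∈ Finset.univ.erase i, w m (x m) := by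
    intro t
    rw [← Finset.mul_prod_erase _ _ (Finset.mem_univ i)]
    congr 1
    · simp
    · refine Finset.prod_congr rfl fun m hm => ?_
      simp [(Finset.mem_erase.1 hm).1]
  have key0 := key 0
  simp only [Pi.single_zero, add_zero] at key0
  simp only [secondDiff]
  rw [key, key, key0, ← Finset.mul_prod_erase _ _ (Finset.mem_univ i)]
  have : ∏ m ∈ Finset.univ.erase i, Function.update w i (secondDiff₁ h (w i)) m (x m) =
      ∏ m ∈ Finset.univ.erase i, w m (x m) :=
    Finset.prod_congr rfl fun m hm => by rw [Function.update_of_ne (Finset.mem_erase.1 hm).1]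
  rw [this, Function.update_self]
  simp only [secondDiff₁]
  ring

theorem foldr_secondDiff_prod {d : ℕ} (e : Finset (Fin d)) (h : Fin d → ℝ) (w : Fin d → ℝ → ℂ)
    (l : List (Fin d)) (hl : l.Nodup) :
    l.foldr (fun i g => if i ∈ e then secondDiff i (h i) g else g) (fun x => ∏ m, w m (x m)) =
      fun x => ∏ m, (if m ∈ l ∧ m ∈ e then secondDiff₁ (h m) (w m) else w m) (x m) := by
  induction l with
  | nil => simp
  | cons i l ih =>
    rw [List.nodup_cons] at hl
    rw [List.foldr_cons, ih hl.2]
    by_cases hi : i ∈ e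
    · rw [if_pos hi, secondDiff_prod i (h i)
        (fun m => if m ∈ l ∧ m ∈ e then secondDiff₁ (h m) (w m) else w m)]
      funext x
      refine Finset.prod_congr rfl fun m _ => ?_
      rcases eq_or_ne m i with rfl | hm
      · simp [hl.1, hi]
      · simp [hm]
    · rw [if_neg hi]
      funext x
      refine Finset.prod_congr rfl fun m _ => ?_
      rcases eq_or_ne m i with rfl | hm
      · simp [hl.1, hi]
      · simp [hm]

theorem mixedSecondDiff_prod {d : ℕ} (e : Finset (Fin d)) (h : Fin d → ℝ)
    (w : Fin d → ℝ → ℂ) (x : Fin d → ℝ) :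
    mixedSecondDiff e h (fun x => ∏ m, w m (x m)) x =
      ∏ m, (if m ∈ e then secondDiff₁ (h m) (w m) else w m) (x m) := by
  rw [mixedSecondDiff, foldr_secondDiff_prod e h w _ (List.nodup_finRange d)]
  simp

/-- A shift in direction `i` changes only coordinate `i`, and `i` does not recur in the list, so the
room needed for the remaining directions is preserved. -/
theorem foldr_secondDiff_mem {d : ℕ} (e : Finset (Fin d)) (h : Fin d → ℝ) (hh : ∀ i, 0 ≤ h i)
    (l : List (Fin d)) (hl : l.Nodup) (x : Fin d → ℝ) (hx : x ∈ cube d)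
    (hx' : ∀ i ∈ l, i ∈ e → x i + 2 * h i ≤ 1) :
    (fun f => l.foldr (fun i g => if i ∈ e then secondDiff i (h i) g else g) f x) ∈
      pointFunctionals (cube d) := by
  induction l generalizing x with
  | nil => exact eval_mem_pointFunctionals hx
  | cons i l ih =>
    rw [List.nodup_cons] at hl
    by_cases hi : i ∈ e
    · have hi1 := hx' i List.mem_cons_self hi
      have step : ∀ t, 0 ≤ t → t ≤ 2 * h i →
          (fun f => l.foldr (fun i g => if i ∈ e then secondDiff i (h i) g else g) f
            (x + Pi.single i t)) ∈ pointFunctionals (cube d) := by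
        intro t ht0 ht
        have hne : ∀ m, m ≠ i → (x + Pi.single i t : Fin d → ℝ) m = x m := fun m hm => by simp [hm]
        have hself : (x + Pi.single i t : Fin d → ℝ) i = x i + t := by simp
        refine ih hl.2 _ ⟨fun m => ?_, fun m => ?_⟩ fun m hm hme => ?_
        · rcases eq_or_ne m i with rfl | hm
          · rw [hself]; exact add_nonneg (hx.1 m) ht0
          · rw [hne m hm]; exact hx.1 m
        · rcases eq_or_ne m i with rfl | hm
          · rw [hself]; exact le_trans (by linarith) hi1
          · rw [hne m hm]; exact hx.2 m
        · rw [hne m (by rintro rfl; exact hl.1 hm)]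
          exact hx' m (List.mem_cons_of_mem _ hm) hme
      have h2 := step (2 * h i) (by linarith [hh i]) le_rfl
      have h1 := step (h i) (hh i) (by linarith [hh i])
      have h0 := step 0 le_rfl (by linarith [hh i])
      have := Submodule.add_mem _ (Submodule.sub_mem _ h2 (Submodule.smul_mem _ (2 : ℂ) h1)) h0
      convert this using 1
      funext f
      simp [hi, secondDiff]
    · simp only [List.foldr_cons, if_neg hi]
      exact ih hl.2 x hx fun m hm => hx' m (List.mem_cons_of_mem _ hm)

/-- The univariate Faber coefficient. -/
def faberCoeff₁ (j : ℤ) (k : ℕ) (w : ℝ → ℂ) : ℂ :=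
  if j = -1 then w k else (-2 : ℂ)⁻¹ * secondDiff₁ ((2 : ℝ) ^ (-(j + 1))) w ((2 : ℝ) ^ (-j) * k)

/-- The part of level `j` of the univariate Faber expansion. -/
def layer₁ (j : ℤ) (w : ℝ → ℂ) (x : ℝ) : ℂ :=
  ∑ k ∈ trans₁ j, faberCoeff₁ j k w * (faber₁ j k x : ℂ)

/-- The part of level `j` of the tensor Faber expansion. -/
def layer {d : ℕ} (j : Fin d → ℤ) (f : (Fin d → ℝ) → ℂ) (x : Fin d → ℝ) : ℂ :=
  ∑ k ∈ trans j, faberCoeff j k f * (faber j k x : ℂ)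

theorem smolyak_eq_sum_layer {d : ℕ} (n : ℕ) (f : (Fin d → ℝ) → ℂ) (x : Fin d → ℝ) :
    smolyak n f x = ∑ j ∈ levels d n, layer j f x := rfl

theorem faberCoeff_prod {d : ℕ} (j : Fin d → ℤ) (hj : ∀ i, -1 ≤ j i) (k : Fin d → ℕ)
    (w : Fin d → ℝ → ℂ) :
    faberCoeff j k (fun x => ∏ m, w m (x m)) = ∏ m, faberCoeff₁ (j m) (k m) (w m) := by
  have hc : ((-2 : ℂ) ^ (active j).card)⁻¹ = ∏ m, if m ∈ active j then (-2 : ℂ)⁻¹ else 1 := by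
    rw [Finset.prod_ite_mem, Finset.univ_inter, Finset.prod_const, inv_pow]
  rw [faberCoeff, mixedSecondDiff_prod, hc, ← Finset.prod_mul_distrib]
  refine Finset.prod_congr rfl fun m _ => ?_
  by_cases hm : j m = -1
  · simp [active, faberCoeff₁, hm, node]
  · have : max (j m) 0 = j m := max_eq_left (by have := hj m; omega)
    simp [active, faberCoeff₁, hm, node, this]

theorem layer_prod {d : ℕ} (j : Fin d → ℤ) (hj : ∀ i, -1 ≤ j i) (w : Fin d → ℝ → ℂ)
    (x : Fin d → ℝ) :
    layer j (fun x => ∏ m, w m (x m)) x = ∏ m, layer₁ (j m) (w m) (x m) := by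
  simp only [layer, layer₁, trans, Finset.prod_univ_sum]
  refine Finset.sum_congr rfl fun k _ => ?_
  rw [faberCoeff_prod j hj, faber, Complex.ofReal_prod, Finset.prod_mul_distrib]

/-- Guarantees that the second differences in the Faber coefficients sample only points of the cube.
-/
theorem node_bounds {j : ℤ} (hj : -1 ≤ j) {k : ℕ} (hk : k ∈ trans₁ j) :
    (0 : ℝ) ≤ (2 : ℝ) ^ (-(max j 0)) * k ∧ (2 : ℝ) ^ (-(max j 0)) * k ≤ 1 ∧
      (j ≠ -1 → (2 : ℝ) ^ (-(max j 0)) * k + 2 * (2 : ℝ) ^ (-(j + 1)) ≤ 1) := by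
  refine ⟨by positivity, ?_⟩
  by_cases h : j = -1
  · subst h
    simp only [trans₁, if_true, Finset.mem_insert, Finset.mem_singleton] at hk
    rcases hk with rfl | rfl <;> simp
  · obtain ⟨m, rfl⟩ : ∃ m : ℕ, j = m := ⟨j.toNat, by omega⟩
    rw [trans₁, if_neg h, Finset.mem_range, Int.toNat_natCast] at hk
    have hk' : (k : ℝ) + 1 ≤ 2 ^ m := by exact_mod_cast hk
    have e1 : (2 : ℝ) ^ (-(max (m : ℤ) 0)) = (2 ^ m)⁻¹ := by
      rw [max_eq_left (by positivity), zpow_neg, zpow_natCast]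
    have e2 : 2 * (2 : ℝ) ^ (-((m : ℤ) + 1)) = (2 ^ m)⁻¹ := by
      rw [neg_add, zpow_add₀ two_ne_zero, zpow_neg, zpow_natCast]; norm_num; ring
    have hp : (0 : ℝ) < 2 ^ m := by positivity
    have key : ((2 : ℝ) ^ m)⁻¹ * k + (2 ^ m)⁻¹ ≤ 1 := by
      rw [← mul_add_one, inv_mul_le_iff₀ hp]; linarith
    rw [e1, e2]
    exact ⟨by have := inv_pos.2 hp; linarith, fun _ => key⟩

theorem layer_mem_pointFunctionals {d : ℕ} (j : Fin d → ℤ) (hj : ∀ i, -1 ≤ j i)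
    (x : Fin d → ℝ) : (fun f => layer j f x) ∈ pointFunctionals (cube d) := by
  have : (fun f => layer j f x) =
      ∑ k ∈ trans j, ((faber j k x : ℂ) * ((-2 : ℂ) ^ (active j).card)⁻¹) •
        fun f => mixedSecondDiff (active j) (fun i => (2 : ℝ) ^ (-(j i + 1))) f (node j k) := by
    funext f
    rw [Finset.sum_apply]
    refine Finset.sum_congr rfl fun k _ => ?_
    rw [faberCoeff, Pi.smul_apply, smul_eq_mul]
    ring
  rw [this]
  refine Submodule.sum_mem _ fun k hk => Submodule.smul_mem _ _ ?_
  have hk' : ∀ i, k i ∈ trans₁ (j i) := Fintype.mem_piFinset.1 hk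
  refine foldr_secondDiff_mem _ _ (fun i => by positivity) _ (List.nodup_finRange d) _
    ⟨fun i => (node_bounds (hj i) (hk' i)).1, fun i => (node_bounds (hj i) (hk' i)).2.1⟩
    fun i _ hi => (node_bounds (hj i) (hk' i)).2.2 (by simpa [active] using hi)

/-! ### The univariate Faber system -/

theorem hat_of_nonpos {x : ℝ} (hx : x ≤ 0) : hat x = 0 := by
  rw [hat, max_eq_left]
  rw [abs_of_nonpos (by linarith)]; linarith

theorem hat_of_one_le {x : ℝ} (hx : 1 ≤ x) : hat x = 0 := by
  rw [hat, max_eq_left]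
  rw [abs_of_nonneg (by linarith)]; linarith

theorem hat_of_le_half {x : ℝ} (h0 : 0 ≤ x) (h1 : x ≤ 1 / 2) : hat x = 2 * x := by
  rw [hat, abs_of_nonpos (by linarith), max_eq_right (by linarith)]; ring

theorem hat_of_half_le {x : ℝ} (h0 : 1 / 2 ≤ x) (h1 : x ≤ 1) : hat x = 2 - 2 * x := by
  rw [hat, abs_of_nonneg (by linarith), max_eq_right (by linarith)]; ring

theorem hat_nonneg (x : ℝ) : 0 ≤ hat x := le_max_left _ _

theorem hat_le_one (x : ℝ) : hat x ≤ 1 :=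
  max_le zero_le_one (by have := abs_nonneg (2 * x - 1); linarith)

theorem continuous_faber₁ (j : ℤ) (k : ℕ) : Continuous (faber₁ j k) := by
  unfold faber₁ hat
  split_ifs <;> fun_prop

theorem layer₁_neg_one (w : ℝ → ℂ) (x : ℝ) :
    layer₁ (-1) w x = (1 - x : ℝ) * w 0 + (x : ℝ) * w 1 := by
  simp [layer₁, trans₁, faberCoeff₁, faber₁]
  ring

/-- Hats of one level have non-overlapping supports, so only `k = q` contributes on cell `q`. Its
coefficient is the deviation of the midpoint value from the chord. -/
theorem layer₁_eq (m q : ℕ) (hq : q < 2 ^ m) (s : ℝ) (h0 : 0 ≤ s) (h1 : s ≤ 1) (w : ℝ → ℂ) :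
    layer₁ m w ((q + s) / 2 ^ m) =
      (hat s : ℂ) * (w ((q + 1 / 2) / 2 ^ m) - (w (q / 2 ^ m) + w ((q + 1) / 2 ^ m)) / 2) := by
  have hm : (m : ℤ) ≠ -1 := by omega
  have hp : (2 : ℝ) ^ m ≠ 0 := by positivity
  have harg : ∀ k : ℕ, faber₁ m k ((q + s) / 2 ^ m) = hat (q + s - k) := by
    intro k
    rw [faber₁, if_neg hm, zpow_natCast]
    congr 1
    field_simp
  rw [layer₁, trans₁, if_neg hm, Int.toNat_natCast,
    Finset.sum_eq_single_of_mem q (Finset.mem_range.2 hq)]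
  · have e : (2 : ℝ) ^ (-((m : ℤ) + 1)) = 1 / 2 / 2 ^ m := by
      rw [neg_add, zpow_add₀ two_ne_zero, zpow_neg, zpow_natCast]; norm_num; ring
    have e' : (2 : ℝ) ^ (-(m : ℤ)) = 1 / 2 ^ m := by
      rw [zpow_neg, zpow_natCast, one_div]
    rw [harg, add_sub_cancel_left, faberCoeff₁, if_neg hm, secondDiff₁, e, e',
      show (1 / 2 ^ m * q + 2 * (1 / 2 / 2 ^ m) : ℝ) = (q + 1) / 2 ^ m by ring,
      show (1 / 2 ^ m * q + (1 / 2 / 2 ^ m) : ℝ) = (q + 1 / 2) / 2 ^ m by ring,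
      show (1 / 2 ^ m * q : ℝ) = q / 2 ^ m by ring]
    ring
  · intro k _ hk
    rw [harg]
    rcases lt_or_gt_of_ne hk with h | h
    · have : (k : ℝ) + 1 ≤ q := by exact_mod_cast h
      rw [hat_of_one_le (by linarith)]; simp
    · have : (q : ℝ) + 1 ≤ k := by exact_mod_cast h
      rw [hat_of_nonpos (by linarith)]; simp

/-- The partial sums of the univariate Faber expansion are piecewise linear interpolants. -/
theorem sum_layer₁_eq (w : ℝ → ℂ) (m : ℕ) : ∀ k : ℕ, k < 2 ^ m → ∀ t : ℝ, 0 ≤ t → t ≤ 1 →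
    ∑ j ∈ Finset.Ico (-1 : ℤ) m, layer₁ j w ((k + t) / 2 ^ m) =
      (1 - t : ℝ) * w (k / 2 ^ m) + (t : ℝ) * w ((k + 1) / 2 ^ m) := by
  induction m with
  | zero =>
    intro k hk t h0 h1
    obtain rfl : k = 0 := by simpa using hk
    rw [show Finset.Ico (-1 : ℤ) ((0 : ℕ) : ℤ) = {-1} by rfl, Finset.sum_singleton, layer₁_neg_one]
    simp
  | succ m ih =>
    intro k hk t h0 h1
    have hsplit : Finset.Ico (-1 : ℤ) ((m + 1 : ℕ) : ℤ) =
        insert (m : ℤ) (Finset.Ico (-1 : ℤ) m) := by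
      ext j; simp only [Finset.mem_insert, Finset.mem_Ico]; push_cast; omega
    -- Cell `k` is the left (even) or right (odd) half of the parent cell `q`. Adding the hat
    -- corrects the chord at the midpoint of `q`, which produces the interpolant on the finer grid.
    obtain ⟨q, hq | hq⟩ := Nat.even_or_odd' k
    · have hqm : q < 2 ^ m := by rw [pow_succ] at hk; omega
      have hx : ((k : ℝ) + t) / 2 ^ (m + 1) = (q + t / 2) / 2 ^ m := by
        rw [hq, pow_succ]; push_cast; field_simp
      rw [hsplit, Finset.sum_insert (by simp), hx, ih q hqm _ (by linarith) (by linarith),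
        layer₁_eq m q hqm _ (by linarith) (by linarith), hat_of_le_half (by linarith) (by linarith)]
      rw [show ((k : ℝ)) / 2 ^ (m + 1) = q / 2 ^ m by rw [hq, pow_succ]; push_cast; field_simp,
        show ((k : ℝ) + 1) / 2 ^ (m + 1) = (q + 1 / 2) / 2 ^ m by
          rw [hq, pow_succ]; push_cast; field_simp]
      push_cast
      ring
    · have hqm : q < 2 ^ m := by rw [pow_succ] at hk; omega
      have hx : ((k : ℝ) + t) / 2 ^ (m + 1) = (q + (1 + t) / 2) / 2 ^ m := by
        rw [hq, pow_succ]; push_cast; field_simp; ring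
      rw [hsplit, Finset.sum_insert (by simp), hx, ih q hqm _ (by linarith) (by linarith),
        layer₁_eq m q hqm _ (by linarith) (by linarith), hat_of_half_le (by linarith) (by linarith)]
      rw [show ((k : ℝ)) / 2 ^ (m + 1) = (q + 1 / 2) / 2 ^ m by
          rw [hq, pow_succ]; push_cast; field_simp,
        show ((k : ℝ) + 1) / 2 ^ (m + 1) = (q + 1) / 2 ^ m by
          rw [hq, pow_succ]; push_cast; field_simp; ring]
      push_cast
      ring

theorem exists_dyadic_cell (m : ℕ) {x : ℝ} (h0 : 0 ≤ x) (h1 : x ≤ 1) :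
    ∃ k : ℕ, k < 2 ^ m ∧ ∃ t : ℝ, 0 ≤ t ∧ t ≤ 1 ∧ x = (k + t) / 2 ^ m := by
  have hp : (0 : ℝ) < 2 ^ m := by positivity
  rcases h1.eq_or_lt with rfl | h1
  · refine ⟨2 ^ m - 1, by have : 0 < 2 ^ m := by positivity
                          omega, 1, zero_le_one, le_rfl, ?_⟩
    rw [Nat.cast_sub Nat.one_le_two_pow]
    push_cast
    field_simp
    ring
  · have hx : 0 ≤ 2 ^ m * x := by positivity
    refine ⟨⌊2 ^ m * x⌋₊, ?_, 2 ^ m * x - ⌊2 ^ m * x⌋₊, ?_, ?_, ?_⟩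
    · rw [Nat.floor_lt hx]
      push_cast
      nlinarith
    · linarith [Nat.floor_le hx]
    · linarith [Nat.lt_floor_add_one (2 ^ m * x)]
    · field_simp
      ring

/-- The partial sums of the univariate Faber expansion are convex combinations of two nearby
values. -/
theorem exists_sum_layer₁_eq (m : ℕ) {x : ℝ} (h0 : 0 ≤ x) (h1 : x ≤ 1) :
    ∃ a b t : ℝ, a ∈ Set.Icc (0 : ℝ) 1 ∧ b ∈ Set.Icc (0 : ℝ) 1 ∧ t ∈ Set.Icc (0 : ℝ) 1 ∧
      |a - x| ≤ (2 ^ m)⁻¹ ∧ |b - x| ≤ (2 ^ m)⁻¹ ∧ ∀ w : ℝ → ℂ,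
        ∑ j ∈ Finset.Ico (-1 : ℤ) m, layer₁ j w x = (1 - t : ℝ) * w a + (t : ℝ) * w b := by
  obtain ⟨k, hk, t, ht0, ht1, rfl⟩ := exists_dyadic_cell m h0 h1
  have hp : (0 : ℝ) < 2 ^ m := by positivity
  have hk' : (k : ℝ) + 1 ≤ 2 ^ m := by exact_mod_cast hk
  refine ⟨k / 2 ^ m, (k + 1) / 2 ^ m, t, ⟨by positivity, ?_⟩, ⟨by positivity, ?_⟩, ⟨ht0, ht1⟩,
    ?_, ?_, fun w => sum_layer₁_eq w m k hk t ht0 ht1⟩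
  · rw [div_le_one hp]; linarith
  · rw [div_le_one hp]; linarith
  · rw [← sub_div, abs_div, abs_of_pos hp, ← one_div, div_le_div_iff_of_pos_right hp, abs_le]
    constructor <;> linarith
  · rw [← sub_div, abs_div, abs_of_pos hp, ← one_div, div_le_div_iff_of_pos_right hp, abs_le]
    constructor <;> linarith

/-! ### L_1 bounds for the univariate layers of a kernel -/

theorem lintegral_sum_layer₁_le (K : ℝ → ℂ) (hK : Continuous K) (m : ℕ) {x : ℝ} (h0 : 0 ≤ x)
    (h1 : x ≤ 1) :
    ∫⁻ y, ‖∑ j ∈ Finset.Ico (-1 : ℤ) m, layer₁ j (fun a => K (a - y)) x‖ₑ ≤ ∫⁻ y, ‖K y‖ₑ := by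
  obtain ⟨a, b, t, -, -, ⟨ht0, ht1⟩, -, -, h⟩ := exists_sum_layer₁_eq m h0 h1
  calc ∫⁻ y, ‖∑ j ∈ Finset.Ico (-1 : ℤ) m, layer₁ j (fun a => K (a - y)) x‖ₑ
      ≤ ∫⁻ y, (ENNReal.ofReal (1 - t) * ‖K (a - y)‖ₑ + ENNReal.ofReal t * ‖K (b - y)‖ₑ) := by
        refine lintegral_mono fun y => ?_
        rw [h]
        refine (enorm_add_le _ _).trans (le_of_eq ?_)
        rw [enorm_mul, enorm_mul, ← ofReal_norm ((1 - t : ℝ) : ℂ),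
          ← ofReal_norm (t : ℂ), Complex.norm_of_nonneg (by linarith),
          Complex.norm_of_nonneg ht0]
    -- Both translates have the mass of `K`, and the weights `1 - t` and `t` add up to one, so the
    -- bound does not depend on `m`.
    _ = ∫⁻ y, ‖K y‖ₑ := by
        have hm : ∀ c, Measurable fun y => ‖K (c - y)‖ₑ := fun c =>
          (hK.comp (continuous_const.sub continuous_id)).measurable.enorm
        rw [lintegral_add_left ((hm a).const_mul _), lintegral_const_mul _ (hm a),
          lintegral_const_mul _ (hm b), lintegral_sub_left_eq_self (fun y => ‖K y‖ₑ),
          lintegral_sub_left_eq_self (fun y => ‖K y‖ₑ), ← add_mul,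
          ← ENNReal.ofReal_add (by linarith) ht0]
        simp

theorem continuous_layer₁_translate (K : ℝ → ℂ) (hK : Continuous K) (j : ℤ) :
    Continuous fun z : ℝ × ℝ => layer₁ j (fun a => K (a - z.2)) z.1 := by
  unfold layer₁
  refine continuous_finsetSum _ fun k _ => ?_
  have hw : ∀ c : ℝ, Continuous fun z : ℝ × ℝ => K (c - z.2) := fun c =>
    hK.comp (continuous_const.sub continuous_snd)
  have h2 : Continuous fun z : ℝ × ℝ => faberCoeff₁ j k (fun a => K (a - z.2)) := by
    unfold faberCoeff₁
    split_ifs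
    · exact hw _
    · exact continuous_const.mul (((hw _).sub (continuous_const.mul (hw _))).add (hw _))
  exact h2.mul (Complex.continuous_ofReal.comp ((continuous_faber₁ j k).comp continuous_fst))

/-- A layer is the difference of two consecutive interpolants, each of mass at most that of `K`;
hence the factor 2 at every level. -/
theorem lintegral_layer₁_translate_le (K : ℝ → ℂ) (hK : Continuous K) {j : ℤ} (hj : -1 ≤ j)
    {x : ℝ} (h0 : 0 ≤ x) (h1 : x ≤ 1) :
    ∫⁻ y, ‖layer₁ j (fun a => K (a - y)) x‖ₑ ≤ 2 * ∫⁻ y, ‖K y‖ₑ := by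
  have hcont : ∀ i, Continuous fun y : ℝ => layer₁ i (fun a => K (a - y)) x := by
    intro i
    have := (continuous_layer₁_translate K hK i).comp (Continuous.prodMk_right x)
    simpa only [Function.comp_def] using this
  by_cases h : j = -1
  · subst h
    have := lintegral_sum_layer₁_le K hK 0 h0 h1
    rw [show Finset.Ico (-1 : ℤ) ((0 : ℕ) : ℤ) = {-1} by rfl] at this
    simp only [Finset.sum_singleton] at this
    refine this.trans ?_
    rw [two_mul]
    exact le_self_add
  · obtain ⟨m, rfl⟩ : ∃ m : ℕ, j = m := ⟨j.toNat, by omega⟩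
    have hsplit : Finset.Ico (-1 : ℤ) ((m + 1 : ℕ) : ℤ) =
        insert (m : ℤ) (Finset.Ico (-1 : ℤ) m) := by
      ext j; simp only [Finset.mem_insert, Finset.mem_Ico]; push_cast; omega
    have hdiff : ∀ w : ℝ → ℂ, layer₁ m w x =
        ∑ j ∈ Finset.Ico (-1 : ℤ) ((m + 1 : ℕ) : ℤ), layer₁ j w x -
          ∑ j ∈ Finset.Ico (-1 : ℤ) m, layer₁ j w x := by
      intro w
      rw [hsplit, Finset.sum_insert (by simp), add_sub_cancel_right]
    calc ∫⁻ y, ‖layer₁ m (fun a => K (a - y)) x‖ₑ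
        ≤ ∫⁻ y, (‖∑ j ∈ Finset.Ico (-1 : ℤ) ((m + 1 : ℕ) : ℤ), layer₁ j (fun a => K (a - y)) x‖ₑ +
          ‖∑ j ∈ Finset.Ico (-1 : ℤ) m, layer₁ j (fun a => K (a - y)) x‖ₑ) := by
          refine lintegral_mono fun y => ?_
          rw [hdiff]
          exact enorm_sub_le
      _ ≤ 2 * ∫⁻ y, ‖K y‖ₑ := by
          rw [lintegral_add_left, two_mul]
          · exact add_le_add (lintegral_sum_layer₁_le K hK _ h0 h1)
              (lintegral_sum_layer₁_le K hK _ h0 h1)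
          · exact (continuous_finsetSum _ fun i _ => hcont i).measurable.enorm

theorem enorm_sub_le_lintegral_deriv {w w' : ℝ → ℂ} (hw : ∀ x, HasDerivAt w (w' x) x)
    (hw' : Continuous w') {a b : ℝ} (hab : a ≤ b) :
    ‖w b - w a‖ₑ ≤ ∫⁻ x in Set.Ioc a b, ‖w' x‖ₑ := by
  rw [← intervalIntegral.integral_eq_sub_of_hasDerivAt (fun x _ => hw x)
    (hw'.intervalIntegrable a b), intervalIntegral.integral_of_le hab]
  exact enorm_integral_le_lintegral_enorm _

theorem enorm_secondDiff₁_le {w w' : ℝ → ℂ} (hw : ∀ x, HasDerivAt w (w' x) x)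
    (hw' : Continuous w') {h : ℝ} (hh : 0 ≤ h) (x : ℝ) :
    ‖secondDiff₁ h w x‖ₑ ≤ ∫⁻ t in Set.Ioc x (x + 2 * h), ‖w' t‖ₑ := by
  have e : secondDiff₁ h w x = (w (x + 2 * h) - w (x + h)) - (w (x + h) - w x) := by
    rw [secondDiff₁]; ring
  rw [e, ← Set.Ioc_union_Ioc_eq_Ioc (b := x + h) (by linarith) (by linarith),
    lintegral_union measurableSet_Ioc]
  · rw [add_comm (lintegral _ _)]
    exact enorm_sub_le.trans (add_le_add (enorm_sub_le_lintegral_deriv hw hw' (by linarith))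
      (enorm_sub_le_lintegral_deriv hw hw' (by linarith)))
  · exact Set.disjoint_left.2 fun t h1 h2 => absurd h1.2 (not_le.2 h2.1)

theorem lintegral_faber₁_le (m k : ℕ) :
    ∫⁻ x, ‖(faber₁ m k x : ℂ)‖ₑ ≤ ENNReal.ofReal (2 ^ m)⁻¹ := by
  have hm : (m : ℤ) ≠ -1 := by omega
  have hp : (0 : ℝ) < 2 ^ m := by positivity
  calc ∫⁻ x, ‖(faber₁ m k x : ℂ)‖ₑ
      ≤ ∫⁻ x, (Set.Icc ((k : ℝ) / 2 ^ m) ((k + 1) / 2 ^ m)).indicator 1 x := by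
        refine lintegral_mono fun x => ?_
        rw [faber₁, if_neg hm, zpow_natCast, ← ofReal_norm,
          Complex.norm_of_nonneg (hat_nonneg _)]
        by_cases hx : x ∈ Set.Icc ((k : ℝ) / 2 ^ m) ((k + 1) / 2 ^ m)
        · rw [Set.indicator_of_mem hx]
          exact ENNReal.ofReal_le_one.2 (hat_le_one _)
        · rw [Set.indicator_of_notMem hx]
          rw [Set.mem_Icc, not_and_or, not_le, not_le, lt_div_iff₀ hp, div_lt_iff₀ hp] at hx
          rcases hx with hx | hx
          · rw [hat_of_nonpos (by linarith)]; simp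
          · rw [hat_of_one_le (by linarith)]; simp
    _ = ENNReal.ofReal (2 ^ m)⁻¹ := by
        rw [lintegral_indicator_one measurableSet_Icc, Real.volume_Icc]
        congr 1
        field_simp
        ring

/-- Each coefficient is at most the variation of `w` on its own cell. The cells are disjoint, so the
coefficients sum to at most the total variation, and each hat contributes mass at most `2^(-m)`. -/
theorem lintegral_layer₁_le_of_nonneg {w w' : ℝ → ℂ} (hw : ∀ x, HasDerivAt w (w' x) x)
    (hw' : Continuous w') (m : ℕ) :
    ∫⁻ x, ‖layer₁ m w x‖ₑ ≤ ENNReal.ofReal (2 ^ m)⁻¹ * ∫⁻ t, ‖w' t‖ₑ := by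
  have hm : (m : ℤ) ≠ -1 := by omega
  have hp : (0 : ℝ) < 2 ^ m := by positivity
  have hmono : Monotone fun k : ℕ => (k : ℝ) / 2 ^ m := fun a b hab => by
    have : (a : ℝ) ≤ b := by exact_mod_cast hab
    simp only
    gcongr
  have hcoef : ∀ k : ℕ, ‖faberCoeff₁ m k w‖ₑ ≤
      ∫⁻ t in Set.Ioc ((k : ℝ) / 2 ^ m) ((k + 1 : ℕ) / 2 ^ m), ‖w' t‖ₑ := by
    intro k
    rw [faberCoeff₁, if_neg hm, enorm_mul]
    have e1 : (2 : ℝ) ^ (-(m : ℤ)) * k = k / 2 ^ m := by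
      rw [zpow_neg, zpow_natCast]; ring
    have e2 : 2 * (2 : ℝ) ^ (-((m : ℤ) + 1)) = 1 / 2 ^ m := by
      rw [neg_add, zpow_add₀ two_ne_zero, zpow_neg, zpow_natCast]; norm_num; ring
    have h1 : ‖(-2 : ℂ)⁻¹‖ₑ ≤ 1 := by
      rw [← ofReal_norm, ENNReal.ofReal_le_one]; norm_num
    have h2 := enorm_secondDiff₁_le hw hw' (h := (2 : ℝ) ^ (-((m : ℤ) + 1))) (by positivity)
      ((2 : ℝ) ^ (-(m : ℤ)) * k)
    rw [e1, e2, ← add_div] at h2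
    rw [e1]
    push_cast
    calc _ ≤ 1 * _ := mul_le_mul' h1 h2
      _ = _ := one_mul _
  calc ∫⁻ x, ‖layer₁ m w x‖ₑ
      ≤ ∫⁻ x, ∑ k ∈ trans₁ m, ‖faberCoeff₁ m k w‖ₑ * ‖(faber₁ m k x : ℂ)‖ₑ := by
        refine lintegral_mono fun x => (enorm_sum_le _ _).trans (le_of_eq ?_)
        simp only [enorm_mul]
    _ = ∑ k ∈ trans₁ m, ‖faberCoeff₁ m k w‖ₑ * ∫⁻ x, ‖(faber₁ m k x : ℂ)‖ₑ := by
        have hc : ∀ k, Measurable fun x => ‖(faber₁ m k x : ℂ)‖ₑ := fun k =>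
          (Complex.continuous_ofReal.comp (continuous_faber₁ m k)).measurable.enorm
        rw [lintegral_finsetSum _ fun k _ => (hc k).const_mul _]
        exact Finset.sum_congr rfl fun k _ => lintegral_const_mul _ (hc k)
    _ ≤ ∑ k ∈ trans₁ m, (∫⁻ t in Set.Ioc ((k : ℝ) / 2 ^ m) ((k + 1 : ℕ) / 2 ^ m), ‖w' t‖ₑ) *
          ENNReal.ofReal (2 ^ m)⁻¹ :=
        Finset.sum_le_sum fun k _ => mul_le_mul' (hcoef k) (lintegral_faber₁_le m k)
    _ ≤ ENNReal.ofReal (2 ^ m)⁻¹ * ∫⁻ t, ‖w' t‖ₑ := by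
        rw [← Finset.sum_mul, mul_comm]
        gcongr
        have hd : Pairwise (Function.onFun Disjoint fun k : ℕ =>
            Set.Ioc ((k : ℝ) / 2 ^ m) ((k + 1 : ℕ) / 2 ^ m)) :=
          hmono.pairwise_disjoint_on_Ioc_succ
        rw [← lintegral_biUnion_finset (hd.set_pairwise _)
          fun _ _ => measurableSet_Ioc]
        exact setLIntegral_le_lintegral _ _

theorem lintegral_layer₁_neg_one_le (w : ℝ → ℂ) (B : ℝ≥0∞) (hB : ∀ x, ‖w x‖ₑ ≤ B) :
    ∫⁻ x in Set.Icc (0 : ℝ) 1, ‖layer₁ (-1) w x‖ₑ ≤ B := by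
  calc ∫⁻ x in Set.Icc (0 : ℝ) 1, ‖layer₁ (-1) w x‖ₑ ≤ ∫⁻ x in Set.Icc (0 : ℝ) 1, B := by
        refine setLIntegral_mono measurable_const fun x hx => ?_
        rw [layer₁_neg_one]
        refine (enorm_add_le _ _).trans ?_
        rw [enorm_mul, enorm_mul, ← ofReal_norm ((1 - x : ℝ) : ℂ),
          ← ofReal_norm (x : ℂ), Complex.norm_of_nonneg (by linarith [hx.2]),
          Complex.norm_of_nonneg hx.1]
        calc _ ≤ ENNReal.ofReal (1 - x) * B + ENNReal.ofReal x * B := by gcongr <;> exact hB _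
          _ = B := by
            rw [← add_mul, ← ENNReal.ofReal_add (by linarith [hx.2]) hx.1]; simp
    _ = B := by simp

theorem pointFunctionals_mul_const {E : Type*} {S : Set E} {L : (E → ℂ) → ℂ}
    (hL : L ∈ pointFunctionals S) (f : E → ℂ) (c : ℂ) : L (fun a => f a * c) = L f * c := by
  induction hL using Submodule.span_induction with
  | mem L hL => obtain ⟨a, ha, rfl⟩ := hL; rfl
  | zero => simp
  | add L M _ _ hL hM => simp [hL, hM, add_mul]
  | smul b L _ hL => simp [hL, mul_assoc]

/-! ### Integral operators with tensor product kernels -/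

theorem enorm_finset_prod {ι : Type*} (s : Finset ι) (f : ι → ℂ) :
    ‖∏ i ∈ s, f i‖ₑ = ∏ i ∈ s, ‖f i‖ₑ := by
  classical
  induction s using Finset.induction_on with
  | empty => simp
  | insert a s ha ih => rw [Finset.prod_insert ha, Finset.prod_insert ha, enorm_mul, ih]

/-- Tonelli's theorem for products of functions of one variable. -/
theorem lintegral_pi_prod {d : ℕ} (μ : Fin d → Measure ℝ) [∀ i, SigmaFinite (μ i)]
    (f : Fin d → ℝ → ℝ≥0∞) (hf : ∀ i, Measurable (f i)) :
    ∫⁻ x : Fin d → ℝ, ∏ i, f i (x i) ∂(Measure.pi μ) = ∏ i, ∫⁻ t, f i t ∂(μ i) := by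
  induction d with
  | zero => simp
  | succ n ih =>
    have hm : Measurable fun x : Fin n → ℝ => ∏ i : Fin n, f i.succ (x i) :=
      Finset.measurable_fun_prod _ fun i _ => (hf _).comp (measurable_pi_apply i)
    calc ∫⁻ x : Fin (n + 1) → ℝ, ∏ i, f i (x i) ∂(Measure.pi μ)
        = ∫⁻ x : ℝ × (Fin n → ℝ), f 0 x.1 * ∏ i : Fin n, f i.succ (x.2 i)
            ∂((μ 0).prod (Measure.pi fun i => μ i.succ)) := by
          rw [← ((measurePreserving_piFinSuccAbove μ 0).symm).lintegral_comp_emb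
            (MeasurableEquiv.measurableEmbedding _)]
          simp_rw [MeasurableEquiv.piFinSuccAbove_symm_apply, Fin.insertNthEquiv,
            Fin.prod_univ_succ, Fin.insertNth_zero, Equiv.coe_fn_mk, Fin.cons_succ,
            Fin.zero_succAbove, Fin.cons_zero]
          rfl
      _ = (∫⁻ t, f 0 t ∂μ 0) * ∏ i : Fin n, ∫⁻ t, f i.succ t ∂(μ i.succ) := by
          rw [← ih (fun i => μ i.succ) _ fun i => hf i.succ,
            ← lintegral_prod_mul (hf 0).aemeasurable hm.aemeasurable]
      _ = ∏ i, ∫⁻ t, f i t ∂(μ i) := by rw [Fin.prod_univ_succ]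

/-- Hölder's inequality after splitting `T = T^(1-1/p) T^(1/p)`; in this form `p = 1` needs no
separate treatment. -/
theorem lintegral_mul_rpow_le {α : Type*} [MeasurableSpace α] {μ : Measure α} {p : ℝ} (hp : 1 ≤ p)
    {T U : α → ℝ≥0∞} (hT : AEMeasurable T μ) (hU : AEMeasurable U μ) :
    (∫⁻ y, T y * U y ∂μ) ^ p ≤ (∫⁻ y, T y ∂μ) ^ (p - 1) * ∫⁻ y, T y * U y ^ p ∂μ := by
  have hp0 : 0 < p := by linarith
  have h1 : 0 ≤ 1 - 1 / p := by rw [sub_nonneg, div_le_one hp0]; exact hp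
  have hfac : ∀ y, T y * U y = T y ^ (1 - 1 / p) * (T y * U y ^ p) ^ (1 / p) := by
    intro y
    rw [ENNReal.mul_rpow_of_nonneg _ _ (by positivity), ← ENNReal.rpow_mul, ← mul_assoc,
      ← ENNReal.rpow_add_of_nonneg _ _ h1 (by positivity), mul_one_div_cancel hp0.ne']
    simp
  calc (∫⁻ y, T y * U y ∂μ) ^ p
      = (∫⁻ y, T y ^ (1 - 1 / p) * (T y * U y ^ p) ^ (1 / p) ∂μ) ^ p := by simp_rw [← hfac]
    _ ≤ ((∫⁻ y, T y ∂μ) ^ (1 - 1 / p) * (∫⁻ y, T y * U y ^ p ∂μ) ^ (1 / p)) ^ p := by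
        gcongr
        exact ENNReal.lintegral_mul_norm_pow_le hT (hT.mul (hU.pow_const _)) h1 (by positivity)
          (by ring)
    _ = (∫⁻ y, T y ∂μ) ^ (p - 1) * ∫⁻ y, T y * U y ^ p ∂μ := by
        rw [ENNReal.mul_rpow_of_nonneg _ _ hp0.le, ← ENNReal.rpow_mul, ← ENNReal.rpow_mul,
          one_div_mul_cancel hp0.ne', ENNReal.rpow_one, sub_mul, one_div_mul_cancel hp0.ne',
          one_mul]

/-- The Schur test. -/
theorem lintegral_rpow_kernel_le {α β : Type*} [MeasurableSpace α] [MeasurableSpace β]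
    {μ : Measure α} {ν : Measure β} [SFinite μ] [SFinite ν] {p : ℝ} (hp : 1 ≤ p)
    {T : α → β → ℝ≥0∞} (hT : Measurable (Function.uncurry T)) {U : β → ℝ≥0∞} (hU : Measurable U)
    {A B : ℝ≥0∞} (hA : ∀ᵐ x ∂μ, ∫⁻ y, T x y ∂ν ≤ A) (hB : ∀ y, ∫⁻ x, T x y ∂μ ≤ B) :
    ∫⁻ x, (∫⁻ y, T x y * U y ∂ν) ^ p ∂μ ≤ A ^ (p - 1) * (B * ∫⁻ y, U y ^ p ∂ν) := by
  have hm : Measurable (Function.uncurry fun x y => T x y * U y ^ p) :=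
    hT.mul ((hU.comp measurable_snd).pow_const p)
  have hm1 : Measurable fun x => ∫⁻ y, T x y * U y ^ p ∂ν := hm.lintegral_prod_right'
  have hTl : ∀ x, Measurable fun y => T x y := fun x => hT.comp measurable_prodMk_left
  have hTr : ∀ y, Measurable fun x => T x y := fun y => hT.comp measurable_prodMk_right
  calc ∫⁻ x, (∫⁻ y, T x y * U y ∂ν) ^ p ∂μ
      ≤ ∫⁻ x, A ^ (p - 1) * ∫⁻ y, T x y * U y ^ p ∂ν ∂μ := by
        refine lintegral_mono_ae ?_
        filter_upwards [hA] with x hx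
        refine (lintegral_mul_rpow_le hp
          (hTl x).aemeasurable hU.aemeasurable).trans ?_
        have : 0 ≤ p - 1 := by linarith
        gcongr
    _ = A ^ (p - 1) * ∫⁻ y, ∫⁻ x, T x y * U y ^ p ∂μ ∂ν := by
        rw [lintegral_const_mul _ hm1, lintegral_lintegral_swap hm.aemeasurable]
    _ ≤ A ^ (p - 1) * (B * ∫⁻ y, U y ^ p ∂ν) := by
        gcongr
        rw [← lintegral_const_mul _ (hU.pow_const p)]
        refine lintegral_mono fun y => ?_
        rw [lintegral_mul_const _ (hTr y)]
        gcongr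
        exact hB y

/-- Level `-1` has no decay, but there `2 * 2^(-|j|) = 1`, so one formula covers all levels. A
common `B` loses nothing: for a kernel dilated by `2^l`, the supremum and the total variation both
scale like `2^l`. -/
theorem lintegral_Icc_layer₁_le {w w' : ℝ → ℂ} (hw : ∀ x, HasDerivAt w (w' x) x)
    (hw' : Continuous w') {B : ℝ≥0∞} (hB : ∀ x, ‖w x‖ₑ ≤ B) (hB' : ∫⁻ x, ‖w' x‖ₑ ≤ B)
    {j : ℤ} (hj : -1 ≤ j) :
    ∫⁻ x in Set.Icc (0 : ℝ) 1, ‖layer₁ j w x‖ₑ ≤ ENNReal.ofReal (2 * 2 ^ (-|j|)) * B := by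
  by_cases h : j = -1
  · subst h
    refine (lintegral_layer₁_neg_one_le w B hB).trans (le_of_eq ?_)
    norm_num
  · obtain ⟨m, rfl⟩ : ∃ m : ℕ, j = m := ⟨j.toNat, by omega⟩
    refine (setLIntegral_le_lintegral _ _).trans
      ((lintegral_layer₁_le_of_nonneg hw hw' m).trans ?_)
    rw [Nat.abs_cast, zpow_neg, zpow_natCast]
    gcongr
    have : (0 : ℝ) ≤ (2 ^ m)⁻¹ := by positivity
    linarith

/-- The tensor product convolution kernel. -/
def tensorKernel {d : ℕ} (K : Fin d → ℝ → ℂ) (x y : Fin d → ℝ) : ℂ := ∏ i, K i (x i - y i)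

section Kernel

variable {d : ℕ} {K K' : Fin d → ℝ → ℂ} {u : (Fin d → ℝ) → ℂ} {A : ℝ≥0∞} {B : Fin d → ℝ≥0∞}

/-- The layer is a point functional, so it passes under the integral. For fixed `y` the kernel is a
product in `x`, and its layer factorizes. -/
theorem layer_eq_integral (hu : ∀ x, u x = ∫ y, tensorKernel K x y * u y)
    (hint : ∀ x, Integrable fun y => tensorKernel K x y * u y)
    {j : Fin d → ℤ} (hj : ∀ i, -1 ≤ j i) (x : Fin d → ℝ) :
    layer j u x = ∫ y, (∏ i, layer₁ (j i) (fun a => K i (a - y i)) (x i)) * u y := by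
  have hL := layer_mem_pointFunctionals j hj x
  calc layer j u x = layer j (fun a => ∫ y, tensorKernel K a y * u y) x := by
        congr 1; exact funext hu
    _ = ∫ y, layer j (fun a => tensorKernel K a y * u y) x :=
        (pointFunctionals_integral hL (F := fun a y => tensorKernel K a y * u y)
          fun a _ => hint a).2
    _ = ∫ y, (∏ i, layer₁ (j i) (fun a => K i (a - y i)) (x i)) * u y := by
        refine integral_congr_ae (Filter.Eventually.of_forall fun y => ?_)
        have h1 := pointFunctionals_mul_const hL (fun a => tensorKernel K a y) (u y)
        have h2 := layer_prod j hj (fun i a => K i (a - y i)) x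
        simp only at h1 ⊢
        rw [h1, ← h2]
        rfl

/-- The Schur test for the kernel of `layer_eq_integral`. Tonelli reduces both mass bounds to one
variable: `2 * A` per factor in `y`, and the decay in `j i` per factor in `x`. -/
theorem lintegral_layer_rpow_le {p : ℝ} (hp : 1 ≤ p) (hK : ∀ i, Continuous (K i))
    (hKK' : ∀ i x, HasDerivAt (K i) (K' i x) x) (hK' : ∀ i, Continuous (K' i))
    (hA : ∀ i, ∫⁻ x, ‖K i x‖ₑ ≤ A) (hB : ∀ i x, ‖K i x‖ₑ ≤ B i)
    (hB' : ∀ i, ∫⁻ x, ‖K' i x‖ₑ ≤ B i) (hmeas : Measurable u)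
    (hu : ∀ x, u x = ∫ y, tensorKernel K x y * u y)
    (hint : ∀ x, Integrable fun y => tensorKernel K x y * u y)
    {j : Fin d → ℤ} (hj : ∀ i, -1 ≤ j i) :
    ∫⁻ x in cube d, ‖layer j u x‖ₑ ^ p ≤
      ((2 * A) ^ d) ^ (p - 1) * ((∏ i, ENNReal.ofReal (2 * 2 ^ (-|j i|)) * B i) *
        ∫⁻ y, ‖u y‖ₑ ^ p) := by
  have hcont : ∀ i, Continuous fun z : (Fin d → ℝ) × (Fin d → ℝ) =>
      layer₁ (j i) (fun a => K i (a - z.2 i)) (z.1 i) := by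
    intro i
    have h := (continuous_layer₁_translate (K i) (hK i) (j i)).comp
      (((continuous_apply i).comp continuous_fst).prodMk
        ((continuous_apply i).comp continuous_snd) :
        Continuous fun z : (Fin d → ℝ) × (Fin d → ℝ) => (z.1 i, z.2 i))
    simpa only [Function.comp_def] using h
  have hcube : (volume.restrict (cube d) : Measure (Fin d → ℝ)) =
      Measure.pi fun _ : Fin d => volume.restrict (Set.Icc (0 : ℝ) 1) := by
    rw [← Measure.restrict_pi_pi, volume_pi, cube, ← Set.pi_univ_Icc]
    rfl
  have hmemcube : ∀ᵐ x ∂(volume.restrict (cube d) : Measure (Fin d → ℝ)), x ∈ cube d :=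
    ae_restrict_mem measurableSet_Icc
  set T : (Fin d → ℝ) → (Fin d → ℝ) → ℝ≥0∞ := fun x y =>
    ∏ i, ‖layer₁ (j i) (fun a => K i (a - y i)) (x i)‖ₑ with hTdef
  have hT : Measurable (Function.uncurry T) :=
    Finset.measurable_fun_prod _ fun i _ => (hcont i).measurable.enorm
  refine le_trans (lintegral_mono fun x => ?_)
    (lintegral_rpow_kernel_le (μ := volume.restrict (cube d)) (ν := volume) hp hT hmeas.enorm ?_ ?_)
  · rw [layer_eq_integral hu hint hj]
    gcongr
    refine (enorm_integral_le_lintegral_enorm _).trans (lintegral_mono fun y => ?_)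
    rw [enorm_mul, hTdef, enorm_finset_prod]
  · filter_upwards [hmemcube] with x hx
    have hc : ∀ i, Measurable fun t : ℝ => ‖layer₁ (j i) (fun a => K i (a - t)) (x i)‖ₑ := by
      intro i
      have := (continuous_layer₁_translate (K i) (hK i) (j i)).comp (Continuous.prodMk_right (x i))
      simp only [Function.comp_def] at this
      exact this.measurable.enorm
    rw [volume_pi, hTdef,
      lintegral_pi_prod _ (fun i t => ‖layer₁ (j i) (fun a => K i (a - t)) (x i)‖ₑ) hc]
    calc _ ≤ ∏ _i : Fin d, 2 * A := Finset.prod_le_prod' fun i _ =>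
          (lintegral_layer₁_translate_le (K i) (hK i) (hj i) (hx.1 i) (hx.2 i)).trans
            (mul_le_mul' le_rfl (hA i))
      _ = (2 * A) ^ d := by simp
  · intro y
    have hc : ∀ i, Measurable fun t : ℝ => ‖layer₁ (j i) (fun a => K i (a - y i)) t‖ₑ := by
      intro i
      have := (continuous_layer₁_translate (K i) (hK i) (j i)).comp (Continuous.prodMk_left (y i))
      simp only [Function.comp_def] at this
      exact this.measurable.enorm
    rw [hcube, hTdef,
      lintegral_pi_prod _ (fun i t => ‖layer₁ (j i) (fun a => K i (a - y i)) t‖ₑ) hc]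
    refine Finset.prod_le_prod' fun i _ => ?_
    refine lintegral_Icc_layer₁_le (w' := fun a => K' i (a - y i)) (fun a => ?_)
      ((hK' i).comp (continuous_id.sub continuous_const)) (fun a => hB i _) ?_ (hj i)
    · simpa using (hKK' i (a - y i)).comp_sub_const a (y i)
    · rw [lintegral_sub_right_eq_self fun y => ‖K' i y‖ₑ]
      exact hB' i

/-- Nikolskii's inequality by Hölder against the reproducing kernel: its mass enters with power `p -
1`, its supremum with power one. -/
theorem enorm_rpow_le {p : ℝ} (hp : 1 ≤ p) (hK : ∀ i, Continuous (K i))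
    (hA : ∀ i, ∫⁻ x, ‖K i x‖ₑ ≤ A) (hB : ∀ i x, ‖K i x‖ₑ ≤ B i) (hmeas : Measurable u)
    (hu : ∀ x, u x = ∫ y, tensorKernel K x y * u y) (x : Fin d → ℝ) :
    ‖u x‖ₑ ^ p ≤ (A ^ d) ^ (p - 1) * ((∏ i, B i) * ∫⁻ y, ‖u y‖ₑ ^ p) := by
  have hc : ∀ i, Measurable fun t : ℝ => ‖K i (x i - t)‖ₑ := fun i =>
    ((hK i).comp (continuous_const.sub continuous_id)).measurable.enorm
  have hT : Measurable fun y : Fin d → ℝ => ∏ i, ‖K i (x i - y i)‖ₑ :=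
    Finset.measurable_fun_prod _ fun i _ => (hc i).comp (measurable_pi_apply i)
  have hp1 : 0 ≤ p - 1 := by linarith
  calc ‖u x‖ₑ ^ p ≤ (∫⁻ y, (∏ i, ‖K i (x i - y i)‖ₑ) * ‖u y‖ₑ) ^ p := by
        gcongr
        rw [hu x]
        refine (enorm_integral_le_lintegral_enorm _).trans (lintegral_mono fun y => ?_)
        rw [enorm_mul, tensorKernel, enorm_finset_prod]
    _ ≤ (∫⁻ y : Fin d → ℝ, ∏ i, ‖K i (x i - y i)‖ₑ) ^ (p - 1) *
          ∫⁻ y, (∏ i, ‖K i (x i - y i)‖ₑ) * ‖u y‖ₑ ^ p :=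
        lintegral_mul_rpow_le hp hT.aemeasurable hmeas.enorm.aemeasurable
    _ ≤ (A ^ d) ^ (p - 1) * ((∏ i, B i) * ∫⁻ y, ‖u y‖ₑ ^ p) := by
        gcongr ?_ ^ _ * ?_
        · rw [volume_pi, lintegral_pi_prod _ (fun i t => ‖K i (x i - t)‖ₑ) hc]
          calc _ ≤ ∏ _i : Fin d, A := Finset.prod_le_prod' fun i _ => by
                rw [lintegral_sub_left_eq_self fun y => ‖K i y‖ₑ]; exact hA i
            _ = A ^ d := by simp
        · rw [← lintegral_const_mul _ (hmeas.enorm.pow_const p)]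
          refine lintegral_mono fun y => ?_
          gcongr
          exact hB _ _

end Kernel

/-! ### Convergence of the Faber expansion of a continuous function -/

/-- The levels `j` with `-1 ≤ j_i < N`. -/
def boxLevels (d N : ℕ) : Finset (Fin d → ℤ) :=
  Fintype.piFinset fun _ => Finset.Ico (-1 : ℤ) N

theorem neg_one_le_of_mem_boxLevels {d N : ℕ} {j : Fin d → ℤ} (hj : j ∈ boxLevels d N) (i : Fin d) :
    -1 ≤ j i :=
  (Finset.mem_Ico.1 (Fintype.mem_piFinset.1 hj i)).1

/-- The sum of all layers in a box is a convex combination of values at nearby points. -/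
theorem exists_sum_layer_eq {d : ℕ} (N : ℕ) {x : Fin d → ℝ} (hx : x ∈ cube d) :
    ∃ (c : (Fin d → Bool) → ℝ) (P : (Fin d → Bool) → Fin d → ℝ), (∀ s, 0 ≤ c s) ∧ ∑ s, c s = 1 ∧
      (∀ s, P s ∈ cube d) ∧ (∀ s, dist (P s) x ≤ (2 ^ N)⁻¹) ∧ ∀ f : (Fin d → ℝ) → ℂ,
        ∑ j ∈ boxLevels d N, layer j f x = ∑ s, (c s : ℂ) * f (P s) := by
  choose a b t ha hb ht hax hbx h using fun i => exists_sum_layer₁_eq N (hx.1 i) (hx.2 i)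
  -- A Boolean vector selects a vertex of the dyadic box containing `x`; its weight is the product
  -- of the univariate barycentric weights.
  set c : (Fin d → Bool) → ℝ := fun s => ∏ i, if s i then t i else 1 - t i with hc
  set P : (Fin d → Bool) → Fin d → ℝ := fun s i => if s i then b i else a i with hP
  have hPmem : ∀ s, P s ∈ cube d := by
    intro s
    constructor <;> intro i <;> simp only [hP] <;> split_ifs
    exacts [(hb i).1, (ha i).1, (hb i).2, (ha i).2]
  have hexp : ∀ w : Fin d → ℝ → ℂ, ∑ s, (c s : ℂ) * ∏ i, w i (P s i) =
      ∏ i, ((1 - t i : ℝ) * w i (a i) + (t i : ℝ) * w i (b i)) := by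
    intro w
    have := Finset.prod_univ_sum (fun _ : Fin d => (Finset.univ : Finset Bool))
      (fun i s => if s then (t i : ℂ) * w i (b i) else (1 - t i : ℝ) * w i (a i))
    rw [Fintype.piFinset_univ] at this
    simp only [Fintype.sum_bool, if_true, Bool.false_eq_true, if_false] at this
    simp_rw [add_comm ((1 - t _ : ℝ) * _ : ℂ)]
    rw [this]
    refine Finset.sum_congr rfl fun s _ => ?_
    rw [hc, Complex.ofReal_prod, ← Finset.prod_mul_distrib]
    refine Finset.prod_congr rfl fun i _ => ?_
    simp only [hP]
    split_ifs <;> rfl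
  refine ⟨c, P, fun s => Finset.prod_nonneg fun i _ => ?_, ?_, hPmem, fun s => ?_, ?_⟩
  · split_ifs
    · exact (ht i).1
    · linarith [(ht i).2]
  · have := hexp fun _ _ => 1
    simp only [Finset.prod_const_one, mul_one] at this
    have h2 : (∑ s, (c s : ℂ)) = 1 := by
      rw [this]
      refine Finset.prod_eq_one fun i _ => ?_
      push_cast
      ring
    exact_mod_cast h2
  · rw [dist_pi_le_iff (by positivity)]
    intro i
    rw [Real.dist_eq]
    simp only [hP]
    split_ifs
    exacts [hbx i, hax i]
  · have hL : (fun f => ∑ j ∈ boxLevels d N, layer j f x) ∈ pointFunctionals (cube d) := by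
      have : (fun f => ∑ j ∈ boxLevels d N, layer j f x) =
          ∑ j ∈ boxLevels d N, fun f => layer j f x := by
        funext f; rw [Finset.sum_apply]
      rw [this]
      exact Submodule.sum_mem _ fun j hj =>
        layer_mem_pointFunctionals j (neg_one_le_of_mem_boxLevels hj) x
    have hM : (fun f : (Fin d → ℝ) → ℂ => ∑ s, (c s : ℂ) * f (P s)) ∈
        pointFunctionals (cube d) := by
      have : (fun f : (Fin d → ℝ) → ℂ => ∑ s, (c s : ℂ) * f (P s)) =
          ∑ s, (c s : ℂ) • fun f => f (P s) := by
        funext f; rw [Finset.sum_apply]; rfl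
      rw [this]
      exact Submodule.sum_mem _ fun s _ =>
        Submodule.smul_mem _ _ (eval_mem_pointFunctionals (hPmem s))
    -- On products, both the sum over the box and the vertex sum factor into univariate
    -- interpolants.
    refine congrFun (pointFunctionals_ext hL hM fun w => ?_)
    simp only
    rw [hexp, Finset.sum_congr rfl fun j hj =>
      layer_prod j (neg_one_le_of_mem_boxLevels hj) w x, boxLevels,
      ← Finset.prod_univ_sum (fun _ => Finset.Ico (-1 : ℤ) N) fun i j => layer₁ j (w i) (x i)]
    exact Finset.prod_congr rfl fun i _ => h i (w i)

theorem tendsto_sum_layer {d : ℕ} {F : (Fin d → ℝ) → ℂ} (hF : ContinuousOn F (cube d))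
    {x : Fin d → ℝ} (hx : x ∈ cube d) :
    Filter.Tendsto (fun N => ∑ j ∈ boxLevels d N, layer j F x) Filter.atTop (nhds (F x)) := by
  rw [Metric.tendsto_atTop]
  intro ε hε
  obtain ⟨δ, hδ, hFδ⟩ := Metric.continuousOn_iff.1 hF x hx (ε / 2) (half_pos hε)
  obtain ⟨N₀, hN₀⟩ := exists_pow_lt_of_lt_one hδ (show (1 / 2 : ℝ) < 1 by norm_num)
  refine ⟨N₀, fun N hN => ?_⟩
  obtain ⟨c, P, hc, hc1, hP, hPx, h⟩ := exists_sum_layer_eq N hx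
  have hlt : ((2 : ℝ) ^ N)⁻¹ < δ := by
    refine lt_of_le_of_lt ?_ hN₀
    rw [one_div, inv_pow]
    gcongr
    norm_num
  have hFx : F x = ∑ s, (c s : ℂ) * F x := by
    rw [← Finset.sum_mul, ← Complex.ofReal_sum, hc1]; simp
  rw [h, dist_eq_norm, hFx, ← Finset.sum_sub_distrib]
  calc ‖∑ s, ((c s : ℂ) * F (P s) - (c s : ℂ) * F x)‖
      ≤ ∑ s, c s * (ε / 2) := by
        refine (norm_sum_le _ _).trans (Finset.sum_le_sum fun s _ => ?_)
        rw [← mul_sub, norm_mul, Complex.norm_of_nonneg (hc s), ← dist_eq_norm]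
        exact mul_le_mul_of_nonneg_left (hFδ _ (hP s) ((hPx s).trans_lt hlt)).le (hc s)
    _ = ε / 2 := by rw [← Finset.sum_mul, hc1, one_mul]
    _ < ε := half_lt_self hε

/-! ### Counting levels -/

/-- The tail of `j` together with `s` determines `|j 0|`, and the sign then determines `j 0`. Each
tail entry lies in `[-1, s]`, which has `s + 2` elements. -/
theorem card_levels_le (D N s : ℕ) :
    ({j ∈ boxLevels (D + 1) N | ∑ i, (j i).natAbs = s}).card ≤ 2 * (s + 2) ^ D := by
  have hcard : ((Fintype.piFinset fun _ : Fin D => Finset.Icc (-1 : ℤ) s) ×ˢ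
      (Finset.univ : Finset Bool)).card = 2 * (s + 2) ^ D := by
    rw [Finset.card_product, Fintype.card_piFinset_const, Int.card_Icc, Finset.card_univ,
      Fintype.card_bool, mul_comm]
    congr 2
  rw [← hcard]
  refine Finset.card_le_card_of_injOn (fun j => (Fin.tail j, decide (j 0 < 0))) ?_ ?_
  · intro j hj
    rw [Finset.mem_coe, Finset.mem_filter] at hj
    rw [Finset.mem_coe, Finset.mem_product]
    refine ⟨Fintype.mem_piFinset.2 fun i => Finset.mem_Icc.2
      ⟨neg_one_le_of_mem_boxLevels hj.1 _, ?_⟩, Finset.mem_univ _⟩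
    have := Finset.single_le_sum (f := fun i => (j i).natAbs) (fun i _ => Nat.zero_le _)
      (Finset.mem_univ i.succ)
    rw [hj.2] at this
    change j i.succ ≤ s
    omega
  · intro j hj k hk h
    rw [Finset.mem_coe, Finset.mem_filter, Fin.sum_univ_succ] at hj hk
    have ht : Fin.tail j = Fin.tail k := congrArg Prod.fst h
    have hs : decide (j 0 < 0) = decide (k 0 < 0) := congrArg Prod.snd h
    rw [decide_eq_decide] at hs
    have htail : ∀ i : Fin D, j i.succ = k i.succ := fun i => congrFun ht i
    have h0 : j 0 = k 0 := by
      have h1 := hj.2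
      have h2 := hk.2
      simp only [htail] at h1
      omega
    funext i
    exact Fin.cases h0 htail i

theorem sum_geometric_levels_le {a : ℝ} (ha0 : 0 < a) (ha1 : a < 1) (D : ℕ) :
    ∃ C : ℝ, 0 < C ∧ ∀ n : ℕ, 1 ≤ n → ∀ N : ℕ,
      ∑ j ∈ boxLevels (D + 1) N with n < ∑ i, (j i).natAbs, a ^ (∑ i, (j i).natAbs) ≤
        C * (n : ℝ) ^ D * a ^ n := by
  have hsum : Summable fun m : ℕ => (m : ℝ) ^ D * a ^ m :=
    summable_pow_mul_geometric_of_norm_lt_one D (by rwa [Real.norm_of_nonneg ha0.le])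
  set T := ∑' m : ℕ, (m : ℝ) ^ D * a ^ m with hT
  have hT0 : 0 ≤ T := tsum_nonneg fun m => by positivity
  -- The factor `a^(-3)` pays for the index shift from `s - n` to `s - n + 3` below.
  refine ⟨2 * (a ^ 3)⁻¹ * (T + 1), by positivity, fun n hn N => ?_⟩
  set S := {j ∈ boxLevels (D + 1) N | n < ∑ i, (j i).natAbs} with hS
  set t := S.image fun j => ∑ i, (j i).natAbs with ht
  have htn : ∀ s ∈ t, n < s := by
    intro s hs
    obtain ⟨j, hj, rfl⟩ := Finset.mem_image.1 hs
    exact (Finset.mem_filter.1 hj).2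
  have hn' : (1 : ℝ) ≤ n := by exact_mod_cast hn
  have hinj : Set.InjOn (fun s => s - n + 3) (t : Set ℕ) := by
    intro s hs r hr h
    have := htn s hs
    have := htn r hr
    simp only at h
    omega
  calc ∑ j ∈ S, a ^ (∑ i, (j i).natAbs)
      = ∑ s ∈ t, ∑ j ∈ S with ∑ i, (j i).natAbs = s, a ^ (∑ i, (j i).natAbs) :=
        (Finset.sum_fiberwise_of_maps_to (fun j hj => Finset.mem_image_of_mem _ hj) _).symm
    _ ≤ ∑ s ∈ t, 2 * ((s : ℝ) + 2) ^ D * a ^ s := by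
        refine Finset.sum_le_sum fun s _ => ?_
        rw [Finset.sum_congr rfl fun j hj => by rw [(Finset.mem_filter.1 hj).2],
          Finset.sum_const, nsmul_eq_mul]
        gcongr
        have h1 : ({j ∈ S | ∑ i, (j i).natAbs = s}).card ≤ 2 * (s + 2) ^ D :=
          (Finset.card_le_card (Finset.filter_subset_filter _ (Finset.filter_subset _ _))).trans
            (card_levels_le D N s)
        exact_mod_cast h1
    _ ≤ ∑ s ∈ t, 2 * (a ^ 3)⁻¹ * n ^ D * a ^ n *
          (((s - n + 3 : ℕ) : ℝ) ^ D * a ^ (s - n + 3)) := by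
        refine Finset.sum_le_sum fun s hs => ?_
        obtain ⟨m, rfl⟩ := Nat.exists_eq_add_of_lt (htn s hs)
        have e : n + m + 1 - n + 3 = m + 4 := by omega
        rw [e]
        -- For `n ≥ 1` this separates the polynomial factor into `n^D` and a power of `m + 4`, which
        -- the convergent series absorbs.
        have h1 : (((n + m + 1 : ℕ) : ℝ) + 2) ≤ n * ((m + 4 : ℕ) : ℝ) := by
          push_cast
          nlinarith [(Nat.cast_nonneg m : (0 : ℝ) ≤ m)]
        calc 2 * (((n + m + 1 : ℕ) : ℝ) + 2) ^ D * a ^ (n + m + 1)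
            ≤ 2 * (n * ((m + 4 : ℕ) : ℝ)) ^ D * a ^ (n + m + 1) := by gcongr
          _ = _ := by
            rw [mul_pow]
            field_simp
            ring
    _ = 2 * (a ^ 3)⁻¹ * n ^ D * a ^ n *
          ∑ m ∈ t.image fun s => s - n + 3, (m : ℝ) ^ D * a ^ m := by
        rw [← Finset.mul_sum, Finset.sum_image hinj]
    _ ≤ 2 * (a ^ 3)⁻¹ * n ^ D * a ^ n * (T + 1) := by
        gcongr
        exact (hsum.sum_le_tsum _ fun m _ => by positivity).trans (by linarith)
    _ = _ := by ring

theorem levels_eq_filter {d n N : ℕ} (h : n < N) :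
    levels d n = {j ∈ boxLevels d N | ¬ n < ∑ i, (j i).natAbs} := by
  have hcast : ∀ j : Fin d → ℤ, (∑ i, |j i| ≤ (n : ℤ)) ↔ ∑ i, (j i).natAbs ≤ n := by
    intro j
    have : ∑ i, |j i| = ((∑ i, (j i).natAbs : ℕ) : ℤ) := by push_cast; rfl
    rw [this]
    exact Nat.cast_le
  ext j
  simp only [levels, boxLevels, Finset.mem_filter, Fintype.mem_piFinset, Finset.mem_Icc,
    Finset.mem_Ico, hcast, not_lt]
  refine ⟨fun ⟨h1, h2⟩ => ⟨fun i => ⟨(h1 i).1, ?_⟩, h2⟩,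
    fun ⟨h1, h2⟩ => ⟨fun i => ⟨(h1 i).1, ?_⟩, h2⟩⟩
  · have := (h1 i).2
    omega
  · have := Finset.single_le_sum (f := fun i => (j i).natAbs) (fun i _ => Nat.zero_le _)
      (Finset.mem_univ i)
    omega

/-! ### Reproducing kernels for band-limited functions -/

open FourierTransform in
theorem exists_reproducing_schwartz : ∃ κ : SchwartzMap ℝ ℂ, ∀ ξ : ℝ, |ξ| ≤ 2 →
    ∫ t, κ t * Complex.exp (-Complex.I * ((ξ * t : ℝ) : ℂ)) = 1 := by
  -- The kernel is the inverse transform of a bump equal to one on `[-2, 2]`. The rescaled frequency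
  -- `ξ / (2π)` stays in that interval because `2π ≥ 1`.
  let b : ContDiffBump (0 : ℝ) := ⟨2, 3, by norm_num, by norm_num⟩
  have hb : HasCompactSupport fun x : ℝ => (b x : ℂ) :=
    b.hasCompactSupport.comp_left (g := fun x : ℝ => (x : ℂ)) Complex.ofReal_zero
  have hb' : ContDiff ℝ ∞ fun x : ℝ => (b x : ℂ) := Complex.ofRealCLM.contDiff.comp b.contDiff
  let χ : SchwartzMap ℝ ℂ := hb.toSchwartzMap hb'
  refine ⟨𝓕⁻ χ, fun ξ hξ => ?_⟩
  have hπ : (1 : ℝ) ≤ 2 * Real.pi := by linarith [Real.two_le_pi]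
  have h1 : (𝓕 (𝓕⁻ χ)) (ξ / (2 * Real.pi)) = 1 := by
    rw [FourierTransform.fourier_fourierInv_eq]
    change (b (ξ / (2 * Real.pi)) : ℂ) = 1
    rw [b.one_of_mem_closedBall, Complex.ofReal_one]
    rw [mem_closedBall_zero_iff, Real.norm_eq_abs, abs_div,
      abs_of_pos (show (0 : ℝ) < 2 * Real.pi by positivity)]
    exact (div_le_self (abs_nonneg _) hπ).trans hξ
  rw [← h1, SchwartzMap.fourier_coe, Real.fourier_real_eq_integral_exp_smul]
  refine integral_congr_ae (Filter.Eventually.of_forall fun t => ?_)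
  simp only
  rw [smul_eq_mul, mul_comm]
  congr 2
  have : (-2 * Real.pi * t * (ξ / (2 * Real.pi)) : ℝ) = -(ξ * t) := by
    field_simp
  rw [this]
  push_cast
  ring

/-- The dilate of `κ` at frequency scale `2 ^ m`. -/
def dilate (κ : ℝ → ℂ) (m : ℕ) (t : ℝ) : ℂ := (2 : ℂ) ^ m * κ (2 ^ m * t)

theorem enorm_two_pow (m : ℕ) : ‖(2 : ℂ) ^ m‖ₑ = 2 ^ m := by
  rw [← ofReal_norm, norm_pow, Complex.norm_ofNat, ENNReal.ofReal_pow zero_le_two]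
  simp

theorem lintegral_enorm_comp_two_pow (g : ℝ → ℂ) (m : ℕ) :
    2 ^ m * ∫⁻ t, ‖g (2 ^ m * t)‖ₑ = ∫⁻ t, ‖g t‖ₑ := by
  have hp : (0 : ℝ) < 2 ^ m := by positivity
  have hmap := Real.map_volume_mul_left hp.ne'
  have h := lintegral_map_equiv (μ := volume) (fun t => ‖g t‖ₑ)
    (Homeomorph.mulLeft₀ ((2 : ℝ) ^ m) hp.ne').toMeasurableEquiv
  simp only [Homeomorph.toMeasurableEquiv_coe, Homeomorph.coe_mulLeft₀] at h
  rw [← h, hmap, lintegral_smul_measure, smul_eq_mul, ← mul_assoc,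
    abs_of_pos (by positivity),
    ENNReal.ofReal_inv_of_pos hp, ENNReal.ofReal_pow zero_le_two, ENNReal.ofReal_ofNat,
    ENNReal.mul_inv_cancel, one_mul]
  · positivity
  · exact ENNReal.pow_ne_top (by norm_num)

theorem lintegral_dilate (κ : ℝ → ℂ) (hκ : Continuous κ) (m : ℕ) :
    ∫⁻ t, ‖dilate κ m t‖ₑ = ∫⁻ t, ‖κ t‖ₑ := by
  have hm : Measurable fun t => ‖κ (2 ^ m * t)‖ₑ :=
    (hκ.comp (continuous_const.mul continuous_id)).measurable.enorm
  simp only [dilate, enorm_mul, enorm_two_pow]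
  rw [lintegral_const_mul _ hm, lintegral_enorm_comp_two_pow]

/-- Fourier transform of a dilated and translated reproducing kernel. -/
theorem integral_dilate_mul_exp {κ : ℝ → ℂ}
    (hκ : ∀ ξ : ℝ, |ξ| ≤ 2 → ∫ t, κ t * Complex.exp (-Complex.I * ((ξ * t : ℝ) : ℂ)) = 1)
    {m : ℕ} {ξ : ℝ} (hξ : |ξ| ≤ 2 ^ (m + 1)) (x : ℝ) :
    ∫ t, dilate κ m (x - t) * Complex.exp (Complex.I * ((ξ * t : ℝ) : ℂ)) =
      Complex.exp (Complex.I * ((ξ * x : ℝ) : ℂ)) := by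
  have hp : (0 : ℝ) < 2 ^ m := by positivity
  calc ∫ t, dilate κ m (x - t) * Complex.exp (Complex.I * ((ξ * t : ℝ) : ℂ))
      = ∫ t, dilate κ m t * Complex.exp (Complex.I * ((ξ * (x - t) : ℝ) : ℂ)) := by
        rw [← integral_sub_left_eq_self (fun t => dilate κ m t *
          Complex.exp (Complex.I * ((ξ * (x - t) : ℝ) : ℂ))) volume x]
        simp only [sub_sub_cancel]
    _ = ∫ t, (2 ^ m * Complex.exp (Complex.I * ((ξ * x : ℝ) : ℂ))) *
          (κ (2 ^ m * t) * Complex.exp (-Complex.I * ((ξ / 2 ^ m * (2 ^ m * t) : ℝ) : ℂ))) := by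
        refine integral_congr_ae (Filter.Eventually.of_forall fun t => ?_)
        have e : (ξ / 2 ^ m * (2 ^ m * t) : ℝ) = ξ * t := by field_simp
        have e2 : Complex.exp (Complex.I * ((ξ * (x - t) : ℝ) : ℂ)) =
            Complex.exp (Complex.I * ((ξ * x : ℝ) : ℂ)) *
              Complex.exp (-Complex.I * ((ξ * t : ℝ) : ℂ)) := by
          rw [← Complex.exp_add]
          congr 1
          push_cast
          ring
        simp only [e, e2, dilate]
        ring
    _ = Complex.exp (Complex.I * ((ξ * x : ℝ) : ℂ)) := by
        rw [integral_const_mul, Measure.integral_comp_mul_left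
          (fun t => κ t * Complex.exp (-Complex.I * ((ξ / 2 ^ m * t : ℝ) : ℂ))), hκ,
          abs_of_pos (by positivity), Complex.real_smul]
        · push_cast
          field_simp
        · rw [abs_div, abs_of_pos hp, div_le_iff₀ hp]
          rwa [pow_succ, mul_comm] at hξ

section Reproducing

variable {d : ℕ} {κ : ℝ → ℂ}

theorem integrable_dilate (hκi : Integrable κ) (m : ℕ) (x : ℝ) :
    Integrable fun t => dilate κ m (x - t) := by
  have h1 : Integrable (dilate κ m) :=
    (hκi.comp_mul_left' (R := 2 ^ m) (by positivity)).const_mul _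
  exact h1.comp_sub_left x

theorem integrable_tensorKernel_dilate (hκi : Integrable κ) (l : Fin d → ℕ) (x : Fin d → ℝ) :
    Integrable (tensorKernel (fun i => dilate κ (l i)) x) :=
  Integrable.fintype_prod (f := fun i t => dilate κ (l i) (x i - t))
    fun i => integrable_dilate hκi (l i) (x i)

theorem integral_tensorKernel_mul_wave
    (hκ : ∀ ξ : ℝ, |ξ| ≤ 2 → ∫ t, κ t * Complex.exp (-Complex.I * ((ξ * t : ℝ) : ℂ)) = 1)
    {l : Fin d → ℕ} {ξ : Fin d → ℝ} (hξ : ∀ i, |ξ i| ≤ 2 ^ (l i + 1)) (x : Fin d → ℝ) :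
    ∫ y, tensorKernel (fun i => dilate κ (l i)) x y * wave ξ y = wave ξ x := by
  simp only [tensorKernel, wave_eq_prod, ← Finset.prod_mul_distrib]
  rw [integral_fintype_prod_volume_eq_prod fun i t => dilate κ (l i) (x i - t) *
    Complex.exp (Complex.I * ((ξ i * t : ℝ) : ℂ))]
  exact Finset.prod_congr rfl fun i _ => integral_dilate_mul_exp hκ (hξ i) (x i)

/-- Band-limited functions are reproduced by convolution with the dilated kernels. -/
theorem fourierInv_eq_integral_tensorKernel (hκi : Integrable κ)
    (hκ : ∀ ξ : ℝ, |ξ| ≤ 2 → ∫ t, κ t * Complex.exp (-Complex.I * ((ξ * t : ℝ) : ℂ)) = 1)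
    {l : Fin d → ℕ} {h : (Fin d → ℝ) → ℂ} (hh : Integrable h)
    (hsupp : ∀ ξ, h ξ ≠ 0 → ∀ i, |ξ i| ≤ 2 ^ (l i + 1)) (x : Fin d → ℝ) :
    fourierInv h x = ∫ y, tensorKernel (fun i => dilate κ (l i)) x y * fourierInv h y := by
  -- The transform is moved onto the kernel, where it is a multiple of the plane wave at every
  -- frequency with `h ξ ≠ 0`.
  rw [integral_mul_fourierInv (integrable_tensorKernel_dilate hκi l x) hh]
  simp only [fourierInv_eq]
  rw [← integral_const_mul]
  refine integral_congr_ae (Filter.Eventually.of_forall fun ξ => ?_)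
  by_cases hξ : h ξ = 0
  · simp [hξ]
  · simp only
    rw [integral_tensorKernel_mul_wave hκ (hsupp ξ hξ), wave_comm x ξ]
    ring

end Reproducing

/-! ### Smooth dyadic decompositions -/

section Blocks

variable {d : ℕ} {φ : ℕ → ℝ → ℂ}

theorem IsDyadicUnity.abs_le_of_ne_zero (hφ : IsDyadicUnity φ) {n : ℕ} {x : ℝ} (h : φ n x ≠ 0) :
    |x| ≤ 2 ^ (n + 1) := by
  have hx : x ∈ tsupport (φ n) := subset_tsupport _ h
  rcases Nat.eq_zero_or_pos n with rfl | hn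
  · simpa using hφ.supp_zero hx
  · have := (hφ.supp_succ n hn hx).2
    exact_mod_cast this

theorem IsDyadicUnity.integrable (hφ : IsDyadicUnity φ) (n : ℕ) : Integrable (φ n) := by
  refine (hφ.smooth n).continuous.integrable_of_hasCompactSupport ?_
  refine HasCompactSupport.intro (isCompact_Icc (a := -(2 : ℝ) ^ (n + 1)) (b := 2 ^ (n + 1)))
    fun x hx => ?_
  by_contra h
  exact hx (abs_le.1 (hφ.abs_le_of_ne_zero h))

/-- If `m` is the first index with `φ m x ≠ 0`, then `|x| ≤ 2^(m+1)`, while the support of `φ n`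
with `n ≥ m + 3` requires `|x| ≥ 2^(m+2)`. -/
theorem IsDyadicUnity.exists_support (hφ : IsDyadicUnity φ) (x : ℝ) :
    ∃ m : ℕ, ∀ n, n ∉ Finset.Icc m (m + 2) → φ n x = 0 := by
  classical
  have hex : ∃ n, φ n x ≠ 0 := by
    by_contra! h
    have h1 := hφ.sum_eq_one x
    simp only [h] at h1
    exact zero_ne_one (hasSum_zero.unique h1)
  refine ⟨Nat.find hex, fun n hn => ?_⟩
  by_contra h
  apply hn
  rw [Finset.mem_Icc]
  refine ⟨Nat.find_min' hex h, ?_⟩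
  by_contra! hlt
  have h1 := hφ.abs_le_of_ne_zero (Nat.find_spec hex)
  have h2 := (hφ.supp_succ n (by omega) (subset_tsupport _ h)).1
  have h3 : (2 : ℝ) ^ ((n : ℤ) - 1) = 2 ^ (n - 1) := by
    rw [← zpow_natCast, Nat.cast_sub (by omega)]
    simp
  rw [h3] at h2
  have h4 : (2 : ℝ) ^ (Nat.find hex + 1) < 2 ^ (n - 1) :=
    pow_lt_pow_right₀ one_lt_two (by omega)
  linarith

theorem IsDyadicUnity.exists_norm_le (hφ : IsDyadicUnity φ) :
    ∃ c : ℝ, 0 ≤ c ∧ ∀ n x, ‖φ n x‖ ≤ c := by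
  obtain ⟨c, hc⟩ := hφ.deriv_bound 0
  have h : ∀ n x, ‖φ n x‖ ≤ c := by simpa using hc
  exact ⟨c, (norm_nonneg _).trans (h 0 0), h⟩

theorem IsDyadicUnity.hasSum_prod (hφ : IsDyadicUnity φ) (ξ : Fin d → ℝ) :
    HasSum (fun l : Fin d → ℕ => ∏ i, φ (l i) (ξ i)) 1 := by
  choose m hm using fun i => hφ.exists_support (ξ i)
  have h1 : ∏ i, ∑ n ∈ Finset.Icc (m i) (m i + 2), φ n (ξ i) = 1 :=
    Finset.prod_eq_one fun i _ => (hasSum_sum_of_ne_finset_zero (hm i)).unique (hφ.sum_eq_one _)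
  rw [← h1, Finset.prod_univ_sum]
  refine hasSum_sum_of_ne_finset_zero fun l hl => ?_
  rw [Fintype.mem_piFinset, not_forall] at hl
  obtain ⟨i, hi⟩ := hl
  exact Finset.prod_eq_zero (Finset.mem_univ i) (hm i _ hi)

/-- At most three indices per coordinate are active at a point. Uniformity in the finite set `s`
supplies the majorant for dominated convergence in `tsum_block_ae_eq`. -/
theorem IsDyadicUnity.exists_norm_sum_prod_le (hφ : IsDyadicUnity φ) (d : ℕ) :
    ∃ c : ℝ, ∀ (s : Finset (Fin d → ℕ)) (ξ : Fin d → ℝ),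
      ‖∑ l ∈ s, ∏ i, φ (l i) (ξ i)‖ ≤ c := by
  obtain ⟨c, hc0, hc⟩ := hφ.exists_norm_le
  refine ⟨(3 * c) ^ d, fun s ξ => ?_⟩
  choose m hm using fun i => hφ.exists_support (ξ i)
  calc ‖∑ l ∈ s, ∏ i, φ (l i) (ξ i)‖
      ≤ ∑ l ∈ s, ∏ i, ‖φ (l i) (ξ i)‖ :=
        (norm_sum_le _ _).trans (le_of_eq (by simp only [norm_prod]))
    _ ≤ ∑ l ∈ Fintype.piFinset fun i => Finset.Icc (m i) (m i + 2), ∏ i, ‖φ (l i) (ξ i)‖ := by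
        rw [← Finset.sum_filter_ne_zero]
        refine Finset.sum_le_sum_of_subset_of_nonneg
          (fun l hl => Fintype.mem_piFinset.2 fun i => ?_)
          fun l _ _ => Finset.prod_nonneg fun i _ => norm_nonneg _
        by_contra hi
        exact (Finset.mem_filter.1 hl).2
          (Finset.prod_eq_zero (Finset.mem_univ i) (by rw [hm i _ hi, norm_zero]))
    _ = ∏ i, ∑ n ∈ Finset.Icc (m i) (m i + 2), ‖φ n (ξ i)‖ :=
        (Finset.prod_univ_sum (fun i => Finset.Icc (m i) (m i + 2)) fun i n => ‖φ n (ξ i)‖).symm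
    _ ≤ ∏ _i : Fin d, 3 * c := by
        refine Finset.prod_le_prod (fun i _ => Finset.sum_nonneg fun n _ => norm_nonneg _)
          fun i _ => (Finset.sum_le_sum fun n _ => hc n _).trans (le_of_eq ?_)
        rw [Finset.sum_const, Nat.card_Icc, nsmul_eq_mul]
        congr 1
        rw [show m i + 2 + 1 - m i = 3 by omega]
        norm_num
    _ = (3 * c) ^ d := by simp

theorem integrable_symbol_mul_fourier (hφ : IsDyadicUnity φ) {g : (Fin d → ℝ) → ℂ}
    (hg : Integrable g) (l : Fin d → ℕ) :
    Integrable fun ξ : Fin d → ℝ => (∏ i, φ (l i) (ξ i)) * fourier g ξ :=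
  (Integrable.fintype_prod (f := fun i => φ (l i)) fun i => hφ.integrable (l i)).mul_bdd
    (continuous_fourier hg).aestronglyMeasurable
    (Filter.Eventually.of_forall fun ξ => norm_fourier_le g ξ)

theorem continuous_block (hφ : IsDyadicUnity φ) {g : (Fin d → ℝ) → ℂ} (hg : Integrable g)
    (l : Fin d → ℕ) : Continuous (block φ g l) :=
  continuous_fourierInv (integrable_symbol_mul_fourier hφ hg l)

theorem block_eq_integral (hφ : IsDyadicUnity φ) {g : (Fin d → ℝ) → ℂ} (hg : Integrable g)
    {κ : ℝ → ℂ} (hκi : Integrable κ)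
    (hκ : ∀ ξ : ℝ, |ξ| ≤ 2 → ∫ t, κ t * Complex.exp (-Complex.I * ((ξ * t : ℝ) : ℂ)) = 1)
    (l : Fin d → ℕ) (x : Fin d → ℝ) :
    block φ g l x = ∫ y, tensorKernel (fun i => dilate κ (l i)) x y * block φ g l y :=
  fourierInv_eq_integral_tensorKernel hκi hκ (integrable_symbol_mul_fourier hφ hg l)
    (fun _ hξ i => hφ.abs_le_of_ne_zero (Finset.prod_ne_zero_iff.1 (left_ne_zero_of_mul hξ) i
      (Finset.mem_univ i))) x

theorem integrable_tensorKernel_mul_block (hφ : IsDyadicUnity φ) {g : (Fin d → ℝ) → ℂ}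
    (hg : Integrable g) {κ : ℝ → ℂ} (hκi : Integrable κ) (l : Fin d → ℕ) (x : Fin d → ℝ) :
    Integrable fun y => tensorKernel (fun i => dilate κ (l i)) x y * block φ g l y :=
  (integrable_tensorKernel_dilate hκi l x).mul_bdd
    (continuous_block hφ hg l).aestronglyMeasurable
    (Filter.Eventually.of_forall fun y => norm_fourierInv_le _ y)

/-- An integrable function is the sum of its building blocks, if that sum converges
uniformly. -/
theorem tsum_block_ae_eq (hφ : IsDyadicUnity φ) {g : (Fin d → ℝ) → ℂ} (hg : Integrable g)
    {b : (Fin d → ℕ) → ℝ} (hb : Summable b) (hgb : ∀ l x, ‖block φ g l x‖ ≤ b l) :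
    g =ᵐ[volume] fun x => ∑' l, block φ g l x := by
  have hcont : Continuous fun x => ∑' l, block φ g l x :=
    continuous_tsum (fun l => continuous_block hφ hg l) hb hgb
  refine ae_eq_of_integral_contDiff_smul_eq hg.locallyIntegrable hcont.locallyIntegrable
    fun ψ hψ hs => ?_
  set ψc : (Fin d → ℝ) → ℂ := fun x => (ψ x : ℂ) with hψc
  have hψc1 : ContDiff ℝ ∞ ψc := Complex.ofRealCLM.contDiff.comp hψ
  have hψc2 : HasCompactSupport ψc := hs.comp_left (g := fun x : ℝ => (x : ℂ)) Complex.ofReal_zero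
  have hψi : Integrable ψc := hψc1.continuous.integrable_of_hasCompactSupport hψc2
  obtain ⟨hW, hWψ⟩ := fourier_fourierInv_of_contDiff hψc1 hψc2
  simp only [Complex.real_smul]
  change ∫ x, ψc x * g x = ∫ x, ψc x * ∑' l, block φ g l x
  -- Since `fourier g` is only bounded, inversion is applied to the test function and duality does
  -- the rest.
  have hleft : ∫ x, ψc x * g x = ∫ ξ, fourierInv ψc ξ * fourier g ξ := by
    rw [integral_mul_fourier hW hg]
    simp only [hWψ]
  have hblock : ∀ l, ∫ x, ψc x * block φ g l x =
      ∫ ξ, fourierInv ψc ξ * ((∏ i, φ (l i) (ξ i)) * fourier g ξ) := fun l =>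
    integral_mul_fourierInv hψi (integrable_symbol_mul_fourier hφ hg l)
  have hsum1 : HasSum (fun l => ∫ x, ψc x * block φ g l x)
      (∫ x, ψc x * ∑' l, block φ g l x) := by
    have hint : ∀ l, Integrable fun x => ψc x * block φ g l x := fun l =>
      hψi.mul_bdd (continuous_block hφ hg l).aestronglyMeasurable
        (Filter.Eventually.of_forall fun x => hgb l x)
    have := hasSum_integral_of_summable_integral_norm hint ?_
    · simpa only [tsum_mul_left] using this
    · refine Summable.of_nonneg_of_le (fun l => integral_nonneg fun x => norm_nonneg _)
        (fun l => ?_) (hb.mul_left (∫ x, ‖ψc x‖))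
      rw [← integral_mul_const]
      refine integral_mono (hint l).norm (hψi.norm.mul_const _) fun x => ?_
      simp only [norm_mul]
      exact mul_le_mul_of_nonneg_left (hgb l x) (norm_nonneg _)
  -- On the frequency side the symbols sum to one. Integrability of `fourierInv ψc` makes the
  -- uniform bound on their partial sums an integrable majorant.
  have hsum2 : HasSum
      (fun l : Fin d → ℕ => ∫ ξ, fourierInv ψc ξ * ((∏ i, φ (l i) (ξ i)) * fourier g ξ))
      (∫ ξ, fourierInv ψc ξ * fourier g ξ) := by
    obtain ⟨c, hc⟩ := hφ.exists_norm_sum_prod_le d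
    have hi : ∀ l : Fin d → ℕ, Integrable fun ξ =>
        fourierInv ψc ξ * ((∏ i, φ (l i) (ξ i)) * fourier g ξ) := fun l =>
      (integrable_symbol_mul_fourier hφ hg l).bdd_mul
        (continuous_fourierInv hψi).aestronglyMeasurable
        (Filter.Eventually.of_forall fun x => norm_fourierInv_le _ x)
    rw [HasSum]
    simp only [SummationFilter.unconditional_filter]
    simp_rw [← integral_finsetSum _ fun l _ => hi l]
    have hsumeq : ∀ (s : Finset (Fin d → ℕ)) (ξ : Fin d → ℝ),
        ∑ l ∈ s, fourierInv ψc ξ * ((∏ i, φ (l i) (ξ i)) * fourier g ξ) =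
          fourierInv ψc ξ * ((∑ l ∈ s, ∏ i, φ (l i) (ξ i)) * fourier g ξ) := by
      intro s ξ
      rw [Finset.sum_mul, Finset.mul_sum]
    refine tendsto_integral_filter_of_dominated_convergence
      (fun ξ => ‖fourierInv ψc ξ‖ * (c * (‖fourierConst d‖ * ∫ x, ‖g x‖)))
      (Filter.Eventually.of_forall fun s =>
        (integrable_finsetSum _ fun l _ => hi l).aestronglyMeasurable)
      (Filter.Eventually.of_forall fun s => Filter.Eventually.of_forall fun ξ => ?_)
      (hW.norm.mul_const _) (Filter.Eventually.of_forall fun ξ => ?_)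
    · rw [hsumeq, norm_mul, norm_mul]
      have h1 := hc s ξ
      have h2 := norm_fourier_le g ξ
      have h0 : 0 ≤ c := (norm_nonneg _).trans h1
      gcongr
    · have := ((hφ.hasSum_prod ξ).mul_right (fourier g ξ)).mul_left (fourierInv ψc ξ)
      rw [one_mul] at this
      exact this
  rw [hleft]
  refine hsum2.unique ?_
  simpa only [hblock] using hsum1

end Blocks

/-! ### Estimates for building blocks -/

theorem hasDerivAt_dilate {κ κ' : ℝ → ℂ} (h : ∀ x, HasDerivAt κ (κ' x) x) (m : ℕ) (t : ℝ) :
    HasDerivAt (dilate κ m) (2 ^ m * dilate κ' m t) t := by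
  have h1 : HasDerivAt (fun t : ℝ => (2 : ℝ) ^ m * t) (2 ^ m) t := by
    simpa using (hasDerivAt_id t).const_mul ((2 : ℝ) ^ m)
  have h2 := ((h (2 ^ m * t)).scomp t h1).const_mul ((2 : ℂ) ^ m)
  have e : (2 : ℂ) ^ m * dilate κ' m t = 2 ^ m * ((2 : ℝ) ^ m) • κ' (2 ^ m * t) := by
    simp only [dilate, Complex.real_smul]
    push_cast
    ring
  rw [e]
  exact h2

theorem eLpNorm_rpow_eq {α : Type*} [MeasurableSpace α] {μ : Measure α} {p : ℝ} (hp : 1 ≤ p)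
    (f : α → ℂ) : eLpNorm f (ENNReal.ofReal p) μ ^ p = ∫⁻ x, ‖f x‖ₑ ^ p ∂μ := by
  have hp0 : 0 < p := by linarith
  rw [eLpNorm_eq_lintegral_rpow_enorm_toReal (by simpa using hp0) ENNReal.ofReal_ne_top,
    ENNReal.toReal_ofReal hp0.le, ← ENNReal.rpow_mul, one_div_mul_cancel hp0.ne', ENNReal.rpow_one]

theorem ofReal_two_rpow (r : ℝ) (n : ℕ) :
    ENNReal.ofReal ((2 : ℝ) ^ (r * (n : ℝ))) = ((2 : ℝ≥0∞) ^ n) ^ r := by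
  rw [mul_comm, Real.rpow_mul zero_le_two, Real.rpow_natCast,
    ← ENNReal.ofReal_rpow_of_pos (by positivity), ENNReal.ofReal_pow zero_le_two,
    ENNReal.ofReal_ofNat]

theorem ofReal_two_mul_zpow (j : ℤ) :
    ENNReal.ofReal (2 * 2 ^ (-|j|)) = 2 * (2⁻¹ : ℝ≥0∞) ^ j.natAbs := by
  rw [ENNReal.ofReal_mul zero_le_two, Int.abs_eq_natAbs, zpow_neg, zpow_natCast, ← inv_pow,
    ENNReal.ofReal_pow (by positivity), ENNReal.ofReal_inv_of_pos zero_lt_two, ENNReal.ofReal_ofNat]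

/-- Nikolskii's inequality for the building blocks and the bound for their Faber layers. -/
theorem exists_block_estimates (d : ℕ) {p : ℝ} (hp : 1 ≤ p) :
    ∃ M : ℝ≥0∞, M ≠ ⊤ ∧ ∀ {φ : ℕ → ℝ → ℂ}, IsDyadicUnity φ → ∀ {g : (Fin d → ℝ) → ℂ},
      Integrable g → ∀ l : Fin d → ℕ,
      (∀ x, ‖block φ g l x‖ₑ ≤ M * (ENNReal.ofReal ((2 : ℝ) ^ (1 / p * ((∑ i, l i : ℕ) : ℝ))) *
        eLpNorm (block φ g l) (ENNReal.ofReal p) volume)) ∧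
      ∀ j : Fin d → ℤ, (∀ i, -1 ≤ j i) →
        eLpNorm (layer j (block φ g l)) (ENNReal.ofReal p) (volume.restrict (cube d)) ≤
          ((2⁻¹ : ℝ≥0∞) ^ (1 / p)) ^ (∑ i, (j i).natAbs) *
            (M * (ENNReal.ofReal ((2 : ℝ) ^ (1 / p * ((∑ i, l i : ℕ) : ℝ))) *
              eLpNorm (block φ g l) (ENNReal.ofReal p) volume)) := by
  have hp0 : 0 < p := by linarith
  have hp1 : 0 ≤ p - 1 := by linarith
  have hr : 0 ≤ 1 / p := by positivity
  obtain ⟨κ, hκ⟩ := exists_reproducing_schwartz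
  set A := ∫⁻ t, ‖κ t‖ₑ with hA
  have hAtop : A ≠ ⊤ := (hasFiniteIntegral_iff_enorm.1 κ.integrable.hasFiniteIntegral).ne
  set κ' : ℝ → ℂ := deriv κ with hκ'
  have hderiv : ∀ x, HasDerivAt κ (κ' x) x := fun x => κ.differentiableAt.hasDerivAt
  have hκ'c : Continuous κ' := (SchwartzMap.derivCLM ℂ ℂ κ).continuous
  have hκ'i : Integrable κ' := (SchwartzMap.derivCLM ℂ ℂ κ).integrable
  obtain ⟨s, hs⟩ : ∃ s : ℝ, ∀ x, ‖κ x‖ ≤ s := by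
    obtain ⟨s, -, hs⟩ := κ.decay 0 0
    exact ⟨s, by simpa using hs⟩
  -- One number dominates both the supremum and the total variation of `κ`.
  set m := max (ENNReal.ofReal s) (∫⁻ t, ‖κ' t‖ₑ) with hm
  have hmtop : m ≠ ⊤ := by
    rw [hm, ne_eq, max_eq_top, not_or]
    exact ⟨ENNReal.ofReal_ne_top, (hasFiniteIntegral_iff_enorm.1 hκ'i.hasFiniteIntegral).ne⟩
  -- This is the `p`-th root of the Schur constant, with the powers of two depending on `l` and `j`
  -- removed.
  refine ⟨(((2 * A) ^ d) ^ (p - 1) * (2 * m) ^ d) ^ (1 / p), ?_, ?_⟩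
  · refine ENNReal.rpow_ne_top_of_nonneg hr (ENNReal.mul_ne_top
      (ENNReal.rpow_ne_top_of_nonneg hp1 (ENNReal.pow_ne_top ?_)) (ENNReal.pow_ne_top ?_))
    · exact ENNReal.mul_ne_top (by norm_num) hAtop
    · exact ENNReal.mul_ne_top (by norm_num) hmtop
  intro φ hφ g hg l
  have hKc : ∀ i, Continuous (dilate κ (l i)) := fun i =>
    continuous_const.mul (κ.continuous.comp (continuous_const.mul continuous_id))
  have hK'c : ∀ i, Continuous fun t => (2 : ℂ) ^ (l i) * dilate κ' (l i) t := fun i =>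
    continuous_const.mul
      (continuous_const.mul (hκ'c.comp (continuous_const.mul continuous_id)))
  have hKA : ∀ i, ∫⁻ t, ‖dilate κ (l i) t‖ₑ ≤ A := fun i =>
    (lintegral_dilate κ κ.continuous (l i)).le
  have hKB : ∀ i t, ‖dilate κ (l i) t‖ₑ ≤ 2 ^ l i * m := by
    intro i t
    rw [dilate, enorm_mul, enorm_two_pow]
    gcongr
    rw [← ofReal_norm]
    exact (ENNReal.ofReal_le_ofReal (hs _)).trans (le_max_left _ _)
  have hKB' : ∀ i, ∫⁻ t, ‖(2 : ℂ) ^ (l i) * dilate κ' (l i) t‖ₑ ≤ 2 ^ l i * m := by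
    intro i
    have hmeas : Measurable fun t => ‖dilate κ' (l i) t‖ₑ :=
      (continuous_const.mul
        (hκ'c.comp (continuous_const.mul continuous_id))).measurable.enorm
    simp only [enorm_mul, enorm_two_pow]
    rw [lintegral_const_mul _ hmeas, lintegral_dilate κ' hκ'c]
    gcongr
    exact le_max_right _ _
  have hu := block_eq_integral hφ hg κ.integrable hκ l
  have hint := integrable_tensorKernel_mul_block hφ hg κ.integrable l
  have hmeas : Measurable (block φ g l) := (continuous_block hφ hg l).measurable
  have hroot : ∀ {X Y : ℝ≥0∞}, X ^ p ≤ Y → X ≤ Y ^ (1 / p) := fun {X Y} h => by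
    rwa [one_div, ENNReal.le_rpow_inv_iff hp0]
  have hprod : ∏ i, (2 ^ l i * m) = 2 ^ (∑ i, l i) * m ^ d := by
    rw [Finset.prod_mul_distrib, Finset.prod_pow_eq_pow_sum]
    simp
  have hE : (∫⁻ y, ‖block φ g l y‖ₑ ^ p) ^ (1 / p) =
      eLpNorm (block φ g l) (ENNReal.ofReal p) volume := by
    rw [← eLpNorm_rpow_eq hp, ← ENNReal.rpow_mul, mul_one_div_cancel hp0.ne', ENNReal.rpow_one]
  rw [ofReal_two_rpow]
  refine ⟨fun x => ?_, fun j hj => ?_⟩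
  · have h := enorm_rpow_le hp hKc hKA hKB hmeas hu x
    rw [hprod] at h
    refine hroot (h.trans ?_) |>.trans (le_of_eq ?_) (b := (((2 * A) ^ d) ^ (p - 1) * (2 * m) ^ d *
      (2 ^ (∑ i, l i) * ∫⁻ y, ‖block φ g l y‖ₑ ^ p)) ^ (1 / p))
    -- Nikolskii's bound needs only `A` and `m`; doubling them lets the constant of the layer
    -- estimate serve here too.
    · have h2A : A ≤ 2 * A := by rw [two_mul]; exact le_self_add
      have h2m : m ≤ 2 * m := by rw [two_mul]; exact le_self_add
      calc (A ^ d) ^ (p - 1) * (2 ^ (∑ i, l i) * m ^ d * ∫⁻ y, ‖block φ g l y‖ₑ ^ p)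
          ≤ ((2 * A) ^ d) ^ (p - 1) * (2 ^ (∑ i, l i) * (2 * m) ^ d *
              ∫⁻ y, ‖block φ g l y‖ₑ ^ p) := by gcongr
        _ = _ := by ring
    · rw [ENNReal.mul_rpow_of_nonneg _ _ hr, ENNReal.mul_rpow_of_nonneg (2 ^ (∑ i, l i)) _ hr, hE]
  · have h := lintegral_layer_rpow_le hp hKc (fun i => hasDerivAt_dilate hderiv (l i)) hK'c hKA hKB
      hKB' hmeas hu hint hj
    rw [← eLpNorm_rpow_eq hp] at h
    simp only [ofReal_two_mul_zpow] at h
    rw [Finset.prod_mul_distrib, hprod, Finset.prod_mul_distrib, Finset.prod_pow_eq_pow_sum,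
      Finset.prod_const, Finset.card_univ, Fintype.card_fin] at h
    refine (hroot h).trans (le_of_eq ?_)
    have hcomm : ∀ k : ℕ, ((2⁻¹ : ℝ≥0∞) ^ (1 / p)) ^ k = ((2⁻¹ : ℝ≥0∞) ^ k) ^ (1 / p) := fun k => by
      rw [← ENNReal.rpow_natCast, ← ENNReal.rpow_mul, mul_comm (1 / p), ENNReal.rpow_mul,
        ENNReal.rpow_natCast]
    rw [hcomm, ← hE, ← ENNReal.mul_rpow_of_nonneg _ _ hr,
      ← ENNReal.mul_rpow_of_nonneg _ _ hr, ← ENNReal.mul_rpow_of_nonneg _ _ hr]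
    congr 1
    rw [mul_pow 2 m]
    ring

/-! ### Truncation error and the continuous representative -/

theorem eLpNorm_le_tsum {α ι : Type*} [MeasurableSpace α] [Countable ι] {μ : Measure α} {p : ℝ≥0∞}
    (hp : 1 ≤ p) {u : ι → α → ℂ} {f : α → ℂ} (hu : ∀ i, AEStronglyMeasurable (u i) μ)
    (h : ∀ᵐ x ∂μ, HasSum (fun i => u i x) (f x)) :
    eLpNorm f p μ ≤ ∑' i, eLpNorm (u i) p μ := by
  -- Fatou's lemma needs a sequence; countability of `ι` provides finite sets tending to `atTop`.
  obtain ⟨s, hs⟩ := Filter.exists_seq_tendsto (Filter.atTop : Filter (Finset ι))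
  refine (Lp.eLpNorm_lim_le_liminf_eLpNorm (f := fun n x => ∑ i ∈ s n, u i x)
    (fun n => ?_) f ?_).trans ?_
  · exact Finset.aestronglyMeasurable_fun_sum _ fun i _ => hu i
  · filter_upwards [h] with x hx
    have hx' : Filter.Tendsto (fun t : Finset ι => ∑ i ∈ t, u i x) Filter.atTop (nhds (f x)) := hx
    exact hx'.comp hs
  · refine Filter.liminf_le_of_frequently_le' (Filter.Frequently.of_forall fun n => ?_)
    refine le_trans ?_ (ENNReal.sum_le_tsum (s n))
    have := eLpNorm_sum_le (s := s n) (fun i _ => hu i) hp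
    simpa only [Finset.sum_fn] using this

theorem continuous_layer {d : ℕ} (j : Fin d → ℤ) (f : (Fin d → ℝ) → ℂ) :
    Continuous (layer j f) := by
  refine continuous_finsetSum _ fun k _ => continuous_const.mul (Complex.continuous_ofReal.comp ?_)
  exact continuous_finsetProd _ fun i _ => (continuous_faber₁ _ _).comp (continuous_apply i)

theorem besovNorm_one {d : ℕ} (φ : ℕ → ℝ → ℂ) (r : ℝ) (p : ℝ≥0∞) (g : (Fin d → ℝ) → ℂ) :
    besovNorm φ r p 1 g = ∑' l : Fin d → ℕ,
      ENNReal.ofReal ((2 : ℝ) ^ (r * ((∑ i, l i : ℕ) : ℝ))) * eLpNorm (block φ g l) p volume := by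
  simp [besovNorm]

theorem cube_subset_closure_interior (d : ℕ) : cube d ⊆ closure (interior (cube d)) := by
  rw [cube, ← Set.pi_univ_Icc, interior_pi_set Set.finite_univ, closure_pi_set]
  refine Set.pi_mono fun i _ => ?_
  simp

/-- Equality almost everywhere extends by continuity to the whole cube, boundary included. This
makes Faber coefficients, which sample null sets, independent of the representative. -/
theorem eqOn_of_isContinuousRep {d : ℕ} {f F G : (Fin d → ℝ) → ℂ}
    (hF : IsContinuousRep (cube d) f F) (hG : IsContinuousRep (cube d) f G) :
    Set.EqOn F G (cube d) :=
  Measure.eqOn_of_ae_eq (hF.2.trans hG.2.symm) hF.1 hG.1 (cube_subset_closure_interior d)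

/-- The error of the truncated Faber expansion is at most the sum of the norms of the remaining
layers. -/
theorem eLpNorm_sub_smolyak_le {d : ℕ} {p : ℝ≥0∞} (hp : 1 ≤ p) {F : (Fin d → ℝ) → ℂ}
    (hF : ContinuousOn F (cube d)) (n : ℕ) {R : ℝ≥0∞}
    (hR : ∀ N, ∑ j ∈ boxLevels d N with n < ∑ i, (j i).natAbs,
      eLpNorm (layer j F) p (volume.restrict (cube d)) ≤ R) :
    eLpNorm (fun x => F x - smolyak n F x) p (volume.restrict (cube d)) ≤ R := by
  refine (Lp.eLpNorm_lim_le_liminf_eLpNorm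
    (f := fun N x => ∑ j ∈ boxLevels d N with n < ∑ i, (j i).natAbs, layer j F x)
    (fun N => ?_) _ ?_).trans ?_
  · exact (continuous_finsetSum _ fun j _ => continuous_layer j F).aestronglyMeasurable
  · filter_upwards [ae_restrict_mem measurableSet_Icc] with x hx
    -- Once `N > n`, the box contains all levels of `smolyak n F`, and subtracting them leaves the
    -- layers with `|j|_1 > n`.
    refine ((tendsto_sum_layer hF hx).sub_const (smolyak n F x)).congr' ?_
    filter_upwards [Filter.eventually_gt_atTop n] with N hN
    rw [smolyak_eq_sum_layer, levels_eq_filter hN, sub_eq_iff_eq_add,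
      Finset.sum_filter_add_sum_filter_not]
  · refine Filter.liminf_le_of_frequently_le' (Filter.Frequently.of_forall fun N => ?_)
    refine le_trans ?_ (hR N)
    have := eLpNorm_sum_le (μ := volume.restrict (cube d))
      (s := {j ∈ boxLevels d N | n < ∑ i, (j i).natAbs}) (f := fun j => layer j F)
      (fun j _ => (continuous_layer j F).aestronglyMeasurable) hp
    simpa only [Finset.sum_fn] using this

/-- Functions in the Besov space have a continuous representative, whose Faber layers decay
geometrically. -/
theorem exists_continuousRep_layer_le (d : ℕ) {p : ℝ} (hp : 1 ≤ p) :
    ∃ M : ℝ≥0∞, M ≠ ⊤ ∧ ∀ {φ : ℕ → ℝ → ℂ}, IsDyadicUnity φ → ∀ {f g : (Fin d → ℝ) → ℂ},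
      IsBesovExtension φ (1 / p) (ENNReal.ofReal p) 1 (cube d) f g →
      ∃ G, IsContinuousRep (cube d) f G ∧ ∀ j : Fin d → ℤ, (∀ i, -1 ≤ j i) →
        eLpNorm (layer j G) (ENNReal.ofReal p) (volume.restrict (cube d)) ≤
          ((2⁻¹ : ℝ≥0∞) ^ (1 / p)) ^ (∑ i, (j i).natAbs) *
            (M * besovNorm φ (1 / p) (ENNReal.ofReal p) 1 g) := by
  obtain ⟨M, hM, hblock⟩ := exists_block_estimates d hp
  refine ⟨M, hM, fun {φ} hφ {f g} hg => ?_⟩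
  obtain ⟨⟨hgi, hgN⟩, hgf⟩ := hg
  rw [besovNorm_one] at hgN ⊢
  have hest := fun l => hblock hφ hgi l
  set w : (Fin d → ℕ) → ℝ≥0∞ := fun l =>
    ENNReal.ofReal ((2 : ℝ) ^ (1 / p * ((∑ i, l i : ℕ) : ℝ))) *
      eLpNorm (block φ g l) (ENNReal.ofReal p) volume with hw
  have hfin : ∑' l, M * w l ≠ ⊤ := by
    rw [ENNReal.tsum_mul_left]
    exact ENNReal.mul_ne_top hM hgN.ne
  have hb : Summable fun l => (M * w l).toReal := ENNReal.summable_toReal hfin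
  have hgb : ∀ l x, ‖block φ g l x‖ ≤ (M * w l).toReal := by
    intro l x
    rw [← toReal_enorm]
    exact ENNReal.toReal_mono (ENNReal.ne_top_of_tsum_ne_top hfin l) ((hest l).1 x)
  have hae := tsum_block_ae_eq hφ hgi hb hgb
  have hcont : Continuous fun x => ∑' l, block φ g l x :=
    continuous_tsum (fun l => continuous_block hφ hgi l) hb hgb
  have hsum : ∀ x, HasSum (fun l => block φ g l x) (∑' l, block φ g l x) := fun x =>
    (Summable.of_norm_bounded hb fun l => hgb l x).hasSum
  -- The representative is the sum of the blocks of `g`, uniformly convergent by Nikolskii's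
  -- inequality and finiteness of the Besov norm.
  refine ⟨_, ⟨hcont.continuousOn,
    (hae.symm.filter_mono (ae_mono Measure.restrict_le_self)).trans hgf⟩, fun j hj => ?_⟩
  calc eLpNorm (layer j fun x => ∑' l, block φ g l x) (ENNReal.ofReal p) (volume.restrict (cube d))
      ≤ ∑' l, eLpNorm (layer j (block φ g l)) (ENNReal.ofReal p) (volume.restrict (cube d)) :=
        eLpNorm_le_tsum (ENNReal.one_le_ofReal.2 hp)
          (fun l => (continuous_layer j _).aestronglyMeasurable)
          (Filter.Eventually.of_forall fun x =>
            pointFunctionals_hasSum (layer_mem_pointFunctionals j hj x) fun a _ => hsum a)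
    _ ≤ ∑' l, ((2⁻¹ : ℝ≥0∞) ^ (1 / p)) ^ (∑ i, (j i).natAbs) * (M * w l) :=
        ENNReal.tsum_le_tsum fun l => (hest l).2 j hj
    _ = _ := by rw [ENNReal.tsum_mul_left, ENNReal.tsum_mul_left]

end FaberBesov

end

/-! ### The error estimate -/

theorem theorem6p2 (d : ℕ) (hd : 1 ≤ d) (p : ℝ) (hp : 1 ≤ p)
    (φ : ℕ → ℝ → ℂ) (hφ : FaberBesov.IsDyadicUnity φ) :
    ∃ C : ℝ, 0 < C ∧ ∀ f : (Fin d → ℝ) → ℂ,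
      FaberBesov.MemBesovOn φ (1 / p) (ENNReal.ofReal p) 1 (FaberBesov.cube d) f →
        (∃ F, FaberBesov.IsContinuousRep (FaberBesov.cube d) f F) ∧
        ∀ F, FaberBesov.IsContinuousRep (FaberBesov.cube d) f F →
          ∀ n : ℕ, 1 ≤ n →
            eLpNorm (fun x => f x - FaberBesov.smolyak n F x) (ENNReal.ofReal p)
                (volume.restrict (FaberBesov.cube d)) ≤
              ENNReal.ofReal (C * (2 : ℝ) ^ (-(n : ℝ) / p) * (n : ℝ) ^ (d - 1)) *
                FaberBesov.besovNormOn φ (1 / p) (ENNReal.ofReal p) 1 (FaberBesov.cube d) f := by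
  obtain ⟨D, rfl⟩ : ∃ D, d = D + 1 := ⟨d - 1, by omega⟩
  have hp0 : 0 < p := by linarith
  obtain ⟨M, hM, hrep⟩ := FaberBesov.exists_continuousRep_layer_le (D + 1) hp
  have ha0 : (0 : ℝ) < 2⁻¹ ^ (1 / p) := by positivity
  have ha1 : (2⁻¹ : ℝ) ^ (1 / p) < 1 :=
    Real.rpow_lt_one (by norm_num) (by norm_num) (by positivity)
  have haE : (2⁻¹ : ℝ≥0∞) ^ (1 / p) = ENNReal.ofReal ((2⁻¹ : ℝ) ^ (1 / p)) := by
    rw [← ENNReal.ofReal_rpow_of_pos (by norm_num), ENNReal.ofReal_inv_of_pos zero_lt_two,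
      ENNReal.ofReal_ofNat]
  obtain ⟨C, hC, hcount⟩ := FaberBesov.sum_geometric_levels_le ha0 ha1 D
  refine ⟨(M.toReal + 1) * C, by positivity, fun f hf => ⟨?_, fun F hF n hn => ?_⟩⟩
  · obtain ⟨-, g, hg⟩ := hf
    obtain ⟨G, hG, -⟩ := hrep hφ hg
    exact ⟨G, hG⟩
  · have hn' : (0 : ℝ) < n := by exact_mod_cast hn
    have hc : 0 < (M.toReal + 1) * C * (2 : ℝ) ^ (-(n : ℝ) / p) * (n : ℝ) ^ (D + 1 - 1) := by
      positivity
    -- Dividing by the positive finite constant turns the claim into a lower bound for the infimum,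
    -- to be checked for each extension `g`.
    rw [← ENNReal.div_le_iff' (by simpa using hc) ENNReal.ofReal_ne_top, FaberBesov.besovNormOn]
    refine le_iInf fun g => le_iInf fun hg => ?_
    rw [ENNReal.div_le_iff' (by simpa using hc) ENNReal.ofReal_ne_top]
    obtain ⟨G, hG, hlayer⟩ := hrep hφ hg
    -- The representative `G` depends on `g`, but it agrees with the given `F` on the cube, so the
    -- two have the same layers.
    have hFG := FaberBesov.eqOn_of_isContinuousRep hF hG
    have hfF : eLpNorm (fun x => f x - FaberBesov.smolyak n F x) (ENNReal.ofReal p)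
        (volume.restrict (FaberBesov.cube (D + 1))) =
        eLpNorm (fun x => F x - FaberBesov.smolyak n F x) (ENNReal.ofReal p)
          (volume.restrict (FaberBesov.cube (D + 1))) := by
      refine eLpNorm_congr_ae ?_
      filter_upwards [hF.2] with x hx
      rw [hx]
    rw [hfF]
    refine FaberBesov.eLpNorm_sub_smolyak_le (ENNReal.one_le_ofReal.2 hp) hF.1 n fun N => ?_
    set B := FaberBesov.besovNorm φ (1 / p) (ENNReal.ofReal p) 1 g
    calc ∑ j ∈ FaberBesov.boxLevels (D + 1) N with n < ∑ i, (j i).natAbs,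
          eLpNorm (FaberBesov.layer j F) (ENNReal.ofReal p)
            (volume.restrict (FaberBesov.cube (D + 1)))
        ≤ ∑ j ∈ FaberBesov.boxLevels (D + 1) N with n < ∑ i, (j i).natAbs,
            ENNReal.ofReal (((2⁻¹ : ℝ) ^ (1 / p)) ^ (∑ i, (j i).natAbs)) * (M * B) := by
          refine Finset.sum_le_sum fun j hj => ?_
          have hj1 := FaberBesov.neg_one_le_of_mem_boxLevels (Finset.mem_filter.1 hj).1
          have hFGj : FaberBesov.layer j F = FaberBesov.layer j G := funext fun x =>
            FaberBesov.pointFunctionals_congr (FaberBesov.layer_mem_pointFunctionals j hj1 x) hFG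
          rw [hFGj, ENNReal.ofReal_pow ha0.le, ← haE]
          exact hlayer j hj1
      _ ≤ ENNReal.ofReal (C * (n : ℝ) ^ D * ((2⁻¹ : ℝ) ^ (1 / p)) ^ n) * (M * B) := by
          rw [← Finset.sum_mul, ← ENNReal.ofReal_sum_of_nonneg fun j _ => by positivity]
          gcongr
          exact hcount n hn N
      _ ≤ ENNReal.ofReal ((M.toReal + 1) * C * (2 : ℝ) ^ (-(n : ℝ) / p) * (n : ℝ) ^ (D + 1 - 1)) *
            B := by
          have h1 : ((2⁻¹ : ℝ) ^ (1 / p)) ^ n = (2 : ℝ) ^ (-(n : ℝ) / p) := by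
            rw [← Real.rpow_natCast, ← Real.rpow_mul (by norm_num), Real.inv_rpow zero_le_two,
              ← Real.rpow_neg zero_le_two]
            congr 1
            ring
          rw [h1, ← mul_assoc]
          gcongr
          conv_lhs => rw [← ENNReal.ofReal_toReal hM]
          rw [← ENNReal.ofReal_mul (by positivity)]
          refine ENNReal.ofReal_le_ofReal ?_
          rw [Nat.add_sub_cancel]
          have h2 : 0 ≤ C * (n : ℝ) ^ D * (2 : ℝ) ^ (-(n : ℝ) / p) := by positivity
          nlinarith
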